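/- Let $P=\{x\in\mathbb C:\operatorname{Re}x>0\}$. Say that a function $f$ on $P$ has exponential growth with exponent $\alpha$ if for every $\delta>0$ there is $K>0$ with $|f(x)|\le Ke^{\alpha|x|}$ for all $x\in P$ with $|x|\ge\delta$. Let $a$ be analytic on $P$ and of exponential growth with some exponent $\alpha<\pi$. If there is exactly one function $R_a$ on $P$ that is analytic, has exponential growth with some exponent $\beta<2\pi$, and satisfies $R_a(x)-R_a(x+1)=a(x)$ for $x\in P$ and $\int_1^2R_a(t)\,dt=0$, then the Ramanujan sum of $\sum_{n\ge1}a(n)$ exists and is defined by $\sum_{n\geq 1}^{\mathcal R}a(n)=R_a(1)$. Let $\psi=\Gamma'/\Gamma$, $H_k=\sum_{j=1}^k\frac1j$ (so $H_0=0$), and let the Bernoulli numbers be given by $\frac{z}{e^z-1}=\sum_{n\ge0}B_n\frac{z^n}{n!}$ (so $B_1=-\tfrac12$). **Lemma 1.** For every complex $z$ with $|z|<\pi$ the Ramanujan sum of $\sum_{n\ge1}e^{nz}\log n$ (that is, of $a(x)=e^{xz}\log x$ with the principal logarithm) exists, the integral and the two series below converge absolutely, and $$\sum_{n\geq 1}^{\mathcal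 R}e^{nz}\log n=\frac{e^z}{e^z-1}\int_0^1\psi(x+1)e^{-zx}\,dx+\sum_{k=1}^\infty\frac{z^kH_k}{k!}\left(\frac{1-B_{k+1}}{k+1}\right)+\sum_{k=1}^\infty z^k\sum_{m=1}^{k+1}\frac{B_m}{m!}\,\frac{H_{k-m+1}}{(k-m+1)!},$$ where for $z=0$ the first term on the right is understood as its limit as $z\to0$ (which exists). -/

import Mathlib

open scoped Real Topology

/-- The open right half-plane `P = {x | 0 < Re x}`. -/
def rightHalfPlane : Set ℂ := {x : ℂ | 0 < x.re}

/-- `f` grows at most exponentially on the right half-plane, with exponent `α`: away from the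
boundary point `0` (where functions such as `log x` and `1 / x` are unbounded) one has
`‖f x‖ ≤ K * exp (α * ‖x‖)`. -/
def HasExpGrowth (f : ℂ → ℂ) (α : ℝ) : Prop :=
  ∀ δ : ℝ, 0 < δ → ∃ K : ℝ, 0 < K ∧
    ∀ x ∈ rightHalfPlane, δ ≤ ‖x‖ → ‖f x‖ ≤ K * Real.exp (α * ‖x‖)

/-- `R` is a solution of the normalised difference equation attached to `a`: it is analytic on the
right half-plane (complex differentiable on this open set), of exponential growth with exponent less
than `2π`, satisfies `R x - R (x + 1) = a x` there, and has integral `0` over `[1, 2]`. -/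
structure IsRamanujanRemainder (a R : ℂ → ℂ) : Prop where
  analytic : DifferentiableOn ℂ R rightHalfPlane
  growth : ∃ β : ℝ, β < 2 * π ∧ HasExpGrowth R β
  difference : ∀ x ∈ rightHalfPlane, R x - R (x + 1) = a x
  normalised : ∫ t in (1 : ℝ)..2, R (t : ℂ) = 0

/-- The series `∑_{n ≥ 1} a n` is summable in the sense of Ramanujan with sum `S`: the function `a`
is analytic on the right half-plane and of exponential growth with exponent less than `π`; the
normalised difference equation attached to `a` has a solution `R`, unique on the right half-plane;
and `S = R 1`. -/
def HasRamanujanSum (a : ℂ → ℂ) (S : ℂ) : Prop :=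
  DifferentiableOn ℂ a rightHalfPlane ∧
  (∃ α : ℝ, α < π ∧ HasExpGrowth a α) ∧
  ∃ R : ℂ → ℂ, IsRamanujanRemainder a R ∧
    (∀ R' : ℂ → ℂ, IsRamanujanRemainder a R' → Set.EqOn R' R rightHalfPlane) ∧
    R 1 = S

/-- The term `e^z / (e^z - 1) * ∫₀¹ ψ(x + 1) e^{-z x} dx`, with `ψ` the digamma function. The
expression is meant for `e^z ≠ 1`. -/
noncomputable def digammaTerm (z : ℂ) : ℂ :=
  Complex.exp z / (Complex.exp z - 1) *
    ∫ x in (0 : ℝ)..1, Complex.digamma ((x : ℂ) + 1) * Complex.exp (-z * (x : ℂ))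

/-- The term `z^k H_k / k! * (1 - B_{k+1}) / (k + 1)`, with `B_1 = -1/2`. -/
noncomputable def firstTerm (z : ℂ) (k : ℕ) : ℂ :=
  z ^ k * (harmonic k : ℂ) / (k.factorial : ℂ) *
    ((1 - (bernoulli (k + 1) : ℂ)) / ((k : ℂ) + 1))

/-- The term `z^k ∑_{m=1}^{k+1} (B_m / m!) * H_{k-m+1} / (k-m+1)!`, with `B_1 = -1/2` and
`H_0 = 0`. For `m ≤ k + 1` the index `k - m + 1` is the natural number `k + 1 - m`. -/
noncomputable def secondTerm (z : ℂ) (k : ℕ) : ℂ :=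
  z ^ k * ∑ m ∈ Finset.Icc 1 (k + 1),
    (bernoulli m : ℂ) / (m.factorial : ℂ) *
      ((harmonic (k + 1 - m) : ℂ) / ((k + 1 - m).factorial : ℂ))

/-! Write b(w) = 1/w + 1/(1 - e^w) (`bernKer`) and E_y(w) = e^{yw}/(1 - e^w) + 1/w (`expRem`), both
regular at w = 0. Then E_y - E_{y+1} = e^{yw} and E_y has mean zero over y in [0, 1], so E_y(w)
plays the role of the remainder for the exponential e^{yw}. The logarithm enters through Frullani's
integral log x = ∫ (e^{-d} - e^{-xd}) dd/d. Averaging the exponential remainders accordingly gives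
`rayRem z y`, the integral of e^s (E_y(z) - E_y(s))/(z - s) in the displacement d = z - s, with s
running from z to 0 and then to -∞. It has mean zero on [0, 1], and its first difference is
e^{(y+1)z} log(y+1) (`rayRem_sub`, `integral_rayRem`). The path stays in a half strip away from the
nonzero poles 2πik, which keeps the growth exponent below 2π. Hence x ↦ `rayRem z (x - 1)` is a
Ramanujan remainder.

It is the only one: a difference of two solutions extends to an entire 1-periodic function of
exponential type below 2π, hence is constant, and the normalisation makes the constant 0.

The sum is therefore `rayRem z 0`, where E_0 = b. The segment from z to 0 gives the two series,
since ∫_0^1 (1 - u^k)/(1 - u) du = H_k (`tsum_firstTerm_add_tsum_secondTerm`). The negative axis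
gives the digamma term (`digammaTerm_eq_axisInt`), through Gauss' formula for ψ(x+1) as the integral
of -e^{-t} E_x(-t) over t > 0. The axis integral is continuous at z = 0, which supplies the limit
required there. -/

/-! ### Uniqueness: periodic functions of exponential type less than 2π. -/

section Uniqueness

open Filter Complex Function

/-- A `1`-periodic entire function of exponential type less than `2π` is bounded high up. -/
theorem Function.Periodic.bounded_of_im_ge {f : ℂ → ℂ} (hf : Differentiable ℂ f)
    (hper : Function.Periodic f ((1 : ℝ) : ℂ)) {K β : ℝ} (hβ : β < 2 * π)
    (hbd : ∀ z, ‖f z‖ ≤ K * Real.exp (β * |z.im|)) :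
    ∃ C Y : ℝ, ∀ z : ℂ, Y ≤ z.im → ‖f z‖ ≤ C := by
  -- The factor q = e^{2πiz} has modulus e^{-2π Im z}, so f q tends to 0 high up because β < 2π. A
  -- periodic function with this property is O(|q|), and dividing by q bounds f.
  set h : ℂ → ℂ := fun z => f z * Periodic.qParam 1 z with hh
  have hq : ∀ z, ‖Periodic.qParam 1 z‖ = Real.exp (-2 * π * z.im) := by
    intro z; rw [Periodic.norm_qParam]; simp
  have hqp : Function.Periodic (Periodic.qParam 1) ((1 : ℝ) : ℂ) := by
    intro z
    simp only [Periodic.qParam, ofReal_one, div_one, mul_add, mul_one, exp_add, exp_two_pi_mul_I]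
  have hperh : Function.Periodic h ((1 : ℝ) : ℂ) := hper.mul hqp
  have hdiff : Differentiable ℂ h := hf.mul Periodic.differentiable_qParam
  have hz : ZeroAtFilter (comap im atTop) h := by
    have h1 : Tendsto (fun y : ℝ => K * Real.exp (-((2 * π - β) * y))) atTop (𝓝 0) := by
      have : Tendsto (fun y : ℝ => (2 * π - β) * y) atTop atTop :=
        tendsto_id.const_mul_atTop (by linarith)
      simpa using ((Real.tendsto_exp_neg_atTop_nhds_zero).comp this).const_mul K
    have h2 := h1.comp (tendsto_comap (f := im) (x := atTop))
    refine squeeze_zero_norm' ?_ h2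
    have : ∀ᶠ z : ℂ in comap im atTop, 0 ≤ z.im :=
      tendsto_comap.eventually (eventually_ge_atTop (0 : ℝ))
    filter_upwards [this] with z hz
    rw [hh]
    simp only [norm_mul, hq, comp]
    refine (mul_le_mul_of_nonneg_right (hbd z) (Real.exp_nonneg _)).trans (le_of_eq ?_)
    rw [abs_of_nonneg hz, mul_assoc, ← Real.exp_add]
    ring_nf
  have hdec := Periodic.exp_decay_of_zero_at_inf one_pos hperh
    (Eventually.of_forall fun z => hdiff z) hz
  obtain ⟨C, hC⟩ := hdec.bound
  rw [eventually_comap] at hC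
  obtain ⟨Y, hY⟩ := eventually_atTop.mp hC
  refine ⟨C, Y, fun z hz => ?_⟩
  have := hY z.im hz z rfl
  rw [hh] at this
  simp only [norm_mul, hq, div_one, Real.norm_eq_abs, Real.abs_exp] at this
  exact le_of_mul_le_mul_right this (Real.exp_pos _)

/-- A `1`-periodic entire function of exponential type less than `2π` is constant. -/
theorem Function.Periodic.const_of_exp_type_lt {f : ℂ → ℂ} (hf : Differentiable ℂ f)
    (hper : Function.Periodic f ((1 : ℝ) : ℂ)) {K β : ℝ} (hβ : β < 2 * π)
    (hbd : ∀ z, ‖f z‖ ≤ K * Real.exp (β * |z.im|)) (z w : ℂ) : f z = f w := by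
  obtain ⟨C₁, Y₁, h₁⟩ := Function.Periodic.bounded_of_im_ge hf hper hβ hbd
  have hper' : Function.Periodic (fun z => f (-z)) ((1 : ℝ) : ℂ) := by
    intro z
    have := hper (-z - (1 : ℝ))
    simp only [sub_add_cancel] at this
    change f (-(z + (1 : ℝ))) = f (-z)
    rw [this]; congr 1; ring
  obtain ⟨C₂, Y₂, h₂⟩ := Function.Periodic.bounded_of_im_ge (hf.comp differentiable_neg) hper' hβ
    (fun z => by simpa using hbd (-z))
  have hcpt : IsCompact (Set.Icc (0 : ℝ) 1 ×ℂ Set.Icc (-Y₂) Y₁) :=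
    isCompact_Icc.reProdIm isCompact_Icc
  obtain ⟨C₃, h₃⟩ := hcpt.exists_bound_of_continuousOn hf.continuous.continuousOn
  refine hf.apply_eq_apply_of_bounded (isBounded_iff_forall_norm_le.2
    ⟨max C₁ (max C₂ C₃), ?_⟩) z w
  rintro _ ⟨x, rfl⟩
  rcases le_total Y₁ x.im with h | h
  · exact (h₁ x h).trans (le_max_left _ _)
  rcases le_total Y₂ (-x).im with h' | h'
  · have := h₂ (-x) h'
    simp only [comp, neg_neg] at this
    exact this.trans ((le_max_left _ _).trans (le_max_right _ _))
  · have e : f x = f (x - (⌊x.re⌋ : ℤ) * ((1 : ℝ) : ℂ)) := (hper.sub_int_mul_eq _).symm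
    rw [e]
    refine (h₃ _ ?_).trans ((le_max_right _ _).trans (le_max_right _ _))
    rw [mem_reProdIm]
    simp only [neg_im] at h'
    refine ⟨⟨?_, ?_⟩, ⟨?_, ?_⟩⟩
    · simp
    · simpa using (Int.fract_lt_one x.re).le
    · simp; linarith
    · simpa using h

theorem mem_rightHalfPlane {x : ℂ} : x ∈ rightHalfPlane ↔ 0 < x.re := Iff.rfl

theorem isOpen_rightHalfPlane : IsOpen rightHalfPlane :=
  isOpen_lt continuous_const continuous_re

theorem HasExpGrowth.mono {f : ℂ → ℂ} {α β : ℝ} (h : HasExpGrowth f α) (hαβ : α ≤ β) :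
    HasExpGrowth f β := by
  intro δ hδ
  obtain ⟨K, hK, hb⟩ := h δ hδ
  exact ⟨K, hK, fun x hx hxδ => (hb x hx hxδ).trans (by gcongr)⟩

theorem HasExpGrowth.sub {f g : ℂ → ℂ} {α : ℝ} (hf : HasExpGrowth f α) (hg : HasExpGrowth g α) :
    HasExpGrowth (fun x => f x - g x) α := by
  intro δ hδ
  obtain ⟨K, hK, hb⟩ := hf δ hδ
  obtain ⟨K', hK', hb'⟩ := hg δ hδ
  refine ⟨K + K', by positivity, fun x hx hxδ => (norm_sub_le _ _).trans ?_⟩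
  rw [add_mul]
  exact add_le_add (hb x hx hxδ) (hb' x hx hxδ)

/-- A solution of `f (x + 1) = f x` on the right half-plane which is analytic and of exponential
growth with exponent less than `2π` is constant. -/
theorem eq_of_periodic_of_hasExpGrowth {f : ℂ → ℂ} (hf : DifferentiableOn ℂ f rightHalfPlane)
    {β : ℝ} (hβ : β < 2 * π) (hg : HasExpGrowth f β)
    (hper : ∀ x ∈ rightHalfPlane, f (x + 1) = f x) {x y : ℂ} (hx : x ∈ rightHalfPlane)
    (hy : y ∈ rightHalfPlane) : f x = f y := by
  -- A negative exponent may be raised to 0; nonnegativity makes e^{β‖w‖} monotone in ‖w‖.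
  wlog hβ0 : 0 ≤ β generalizing β
  · exact this (β := 0) (by positivity) (hg.mono (by linarith)) le_rfl
  have hnat : ∀ (n : ℕ) (x : ℂ), x ∈ rightHalfPlane → f (x + n) = f x := by
    intro n
    induction n with
    | zero => intro x _; simp
    | succ n ih =>
      intro x hx
      have : x + n ∈ rightHalfPlane := by
        rw [mem_rightHalfPlane] at *; simp; positivity
      rw [Nat.cast_succ, ← add_assoc, hper _ this, ih x hx]
  have hle : ∀ (m n : ℤ) (z : ℂ), m ≤ n → 0 < z.re + m → f (z + n) = f (z + m) := by
    intro m n z hmn hz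
    obtain ⟨k, rfl⟩ := Int.le.dest hmn
    have := hnat k (z + m) (by rw [mem_rightHalfPlane]; simpa using hz)
    rw [← this]; push_cast; rw [add_assoc]
  have hint : ∀ (m n : ℤ) (z : ℂ), 0 < z.re + m → 0 < z.re + n → f (z + n) = f (z + m) := by
    intro m n z hm hn
    rcases le_total m n with h | h
    · exact hle m n z h hm
    · exact (hle n m z h hn).symm
  -- The shift moves the real part into [1, 2), where the growth bound with δ = 1 applies. Every
  -- shift landing in the half-plane gives the same value, so near a given point one fixed shift can
  -- be used.
  set F : ℂ → ℂ := fun z => f (z + ((1 - ⌊z.re⌋ : ℤ) : ℂ)) with hF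
  have hpos : ∀ z : ℂ, 0 < z.re + ((1 - ⌊z.re⌋ : ℤ) : ℝ) := by
    intro z
    have := Int.floor_le z.re
    push_cast; linarith
  have hFeq : ∀ (n : ℤ) (z : ℂ), 0 < z.re + n → F z = f (z + n) := fun n z hz =>
    hint _ _ z hz (hpos z)
  have hFd : Differentiable ℂ F := by
    intro z
    set n : ℤ := 1 - ⌊z.re⌋
    have ho : {w : ℂ | 0 < w.re + n} ∈ 𝓝 z :=
      (isOpen_lt continuous_const (continuous_re.add continuous_const)).mem_nhds (hpos z)
    have h1 : F =ᶠ[𝓝 z] fun w => f (w + n) := by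
      filter_upwards [ho] with w hw using hFeq n w hw
    refine DifferentiableAt.congr_of_eventuallyEq ?_ h1
    have h2 : DifferentiableAt ℂ f (z + n) :=
      hf.differentiableAt (isOpen_rightHalfPlane.mem_nhds
        (by rw [mem_rightHalfPlane, add_re, intCast_re]; exact hpos z))
    exact h2.comp z (differentiableAt_id.add_const _)
  have hFper : Function.Periodic F ((1 : ℝ) : ℂ) := by
    intro z
    have h1 := hpos (z + 1)
    have h2 := hFeq (1 - ⌊(z + 1).re⌋ + 1) z (by push_cast at h1 ⊢; simp at h1 ⊢; linarith)
    rw [h2, hF]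
    simp only [ofReal_one]
    congr 1; push_cast; ring
  obtain ⟨K, hK, hb⟩ := hg 1 one_pos
  have hFb : ∀ z, ‖F z‖ ≤ (K * Real.exp (β * 2)) * Real.exp (β * |z.im|) := by
    intro z
    set w : ℂ := z + ((1 - ⌊z.re⌋ : ℤ) : ℂ) with hw
    have hre : w.re = z.re + 1 - ⌊z.re⌋ := by rw [hw]; simp; ring
    have him : w.im = z.im := by rw [hw]; simp
    have h1 := Int.floor_le z.re
    have h2 := Int.lt_floor_add_one z.re
    have h3 : (1 : ℝ) ≤ ‖w‖ := (by linarith : (1 : ℝ) ≤ w.re).trans (re_le_norm w)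
    have h4 : ‖w‖ ≤ 2 + |z.im| := by
      refine (norm_le_abs_re_add_abs_im w).trans ?_
      rw [him, abs_of_pos (by linarith)]
      linarith
    refine (hb w (by rw [mem_rightHalfPlane]; linarith) h3).trans ?_
    rw [mul_assoc, ← Real.exp_add, ← mul_add]
    gcongr
  have := Function.Periodic.const_of_exp_type_lt hFd hFper hβ hFb x y
  rw [mem_rightHalfPlane] at hx hy
  rw [hFeq 0 x (by simpa using hx), hFeq 0 y (by simpa using hy)] at this
  simpa using this

/-- The normalised difference equation has at most one solution. -/
theorem IsRamanujanRemainder.eqOn {a R R' : ℂ → ℂ} (h : IsRamanujanRemainder a R)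
    (h' : IsRamanujanRemainder a R') : Set.EqOn R' R rightHalfPlane := by
  obtain ⟨β, hβ, hg⟩ := h.growth
  obtain ⟨β', hβ', hg'⟩ := h'.growth
  have hper : ∀ x ∈ rightHalfPlane, R' (x + 1) - R (x + 1) = R' x - R x := by
    intro x hx
    linear_combination h.difference x hx - h'.difference x hx
  have hconst := fun {x y : ℂ} (hx : x ∈ rightHalfPlane) (hy : y ∈ rightHalfPlane) =>
    eq_of_periodic_of_hasExpGrowth (f := fun x => R' x - R x) (h'.analytic.sub h.analytic)
      (max_lt hβ' hβ) ((hg'.mono (le_max_left _ _)).sub (hg.mono (le_max_right _ _))) hper hx hy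
  have hii : ∀ {Q : ℂ → ℂ}, IsRamanujanRemainder a Q →
      IntervalIntegrable (fun t : ℝ => Q t) MeasureTheory.volume 1 2 := by
    intro Q hQ
    refine ContinuousOn.intervalIntegrable ?_
    refine hQ.analytic.continuousOn.comp continuous_ofReal.continuousOn ?_
    intro t ht
    rw [Set.uIcc_of_le (by norm_num)] at ht
    rw [mem_rightHalfPlane, ofReal_re]; linarith [ht.1]
  intro x hx
  have h0 : ∫ t in (1 : ℝ)..2, (R' (t : ℂ) - R (t : ℂ)) = 0 := by
    rw [intervalIntegral.integral_sub (hii h') (hii h), h.normalised, h'.normalised, sub_zero]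
  have h1 : ∫ t in (1 : ℝ)..2, (R' (t : ℂ) - R (t : ℂ)) = ∫ t in (1 : ℝ)..2, (R' x - R x) := by
    refine intervalIntegral.integral_congr fun t ht => ?_
    rw [Set.uIcc_of_le (by norm_num)] at ht
    exact hconst (by rw [mem_rightHalfPlane, ofReal_re]; linarith [ht.1]) hx
  rw [h1, intervalIntegral.integral_const] at h0
  norm_num at h0
  exact sub_eq_zero.mp h0

end Uniqueness

/-! ### The kernels b and E_y, and their bounds on the half strip. -/

section Kernel

open Filter Complex

/-- The entire function `(e^w - 1) / w`. -/
noncomputable def expQuot : ℂ → ℂ := dslope exp 0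

/-- The function `1 / w + 1 / (1 - e^w)`, extended analytically to `w = 0`. -/
noncomputable def bernKer (w : ℂ) : ℂ := dslope expQuot 0 w / expQuot w

/-- A closed half strip avoiding the poles of `bernKer`. -/
def halfStrip : Set ℂ := {w : ℂ | w.re ≤ π ∧ |w.im| ≤ π}

/-- The function `e^{yw} / (1 - e^w) + 1 / w`, extended analytically to `w = 0`. -/
noncomputable def expRem (y w : ℂ) : ℂ := exp (y * w) * bernKer w - y * expQuot (y * w)

theorem expQuot_of_ne {w : ℂ} (hw : w ≠ 0) : expQuot w = (exp w - 1) / w := by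
  rw [expQuot, dslope_of_ne _ hw, slope_def_field]; simp

theorem expQuot_zero : expQuot 0 = 1 := by
  rw [expQuot, dslope_same]; simp

theorem mul_expQuot (w : ℂ) : w * expQuot w = exp w - 1 := by
  rcases eq_or_ne w 0 with rfl | hw
  · simp
  · rw [expQuot_of_ne hw]; field_simp

theorem differentiable_expQuot : Differentiable ℂ expQuot := by
  rw [← differentiableOn_univ, expQuot, differentiableOn_dslope univ_mem]
  exact differentiable_exp.differentiableOn

theorem continuous_expQuot : Continuous expQuot := differentiable_expQuot.continuous

theorem expQuot_eq_integral (w : ℂ) : expQuot w = ∫ u in (0 : ℝ)..1, exp (w * u) := by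
  rcases eq_or_ne w 0 with rfl | hw
  · simp [expQuot_zero]
  · rw [integral_exp_mul_complex hw, expQuot_of_ne hw]; simp

/-- For Q = `expQuot`, differentiating w Q = e^w - 1 gives (Q - 1)/w + Q' = Q away from 0; letting w
→ 0 yields 2 Q'(0) = Q(0) = 1. -/
theorem deriv_expQuot_zero : deriv expQuot 0 = 1 / 2 := by
  have h1 : ∀ w, expQuot w + w * deriv expQuot w = exp w := by
    intro w
    have h := ((hasDerivAt_id w).mul (differentiable_expQuot w).hasDerivAt).deriv
    have e : (id * expQuot : ℂ → ℂ) = fun w => exp w - 1 := funext fun w => mul_expQuot w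
    rw [e, deriv_sub_const, Complex.deriv_exp] at h
    simpa using h.symm
  have h2 : ∀ w : ℂ, w ≠ 0 → dslope expQuot 0 w + deriv expQuot w = expQuot w := by
    intro w hw
    rw [dslope_of_ne _ hw, slope_def_field, expQuot_zero, sub_zero]
    have := mul_expQuot w
    field_simp
    linear_combination h1 w - this
  have hc : Continuous (dslope expQuot 0) := by
    have : Differentiable ℂ (dslope expQuot 0) := by
      rw [← differentiableOn_univ, differentiableOn_dslope univ_mem]
      exact differentiable_expQuot.differentiableOn
    exact this.continuous
  have hc' : Continuous (deriv expQuot) :=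
    differentiable_expQuot.contDiff (n := 1) |>.continuous_deriv le_rfl
  have h3 := congrFun (Continuous.ext_on (dense_compl_singleton (0 : ℂ)) (hc.add hc')
    continuous_expQuot fun w hw => h2 w hw) 0
  simp only [Pi.add_apply, dslope_same, expQuot_zero] at h3
  linear_combination h3 / 2

theorem exp_ne_one_of_im_lt {w : ℂ} (hw : |w.im| < 2 * π) (h0 : w ≠ 0) : exp w ≠ 1 := by
  intro h
  obtain ⟨n, hn⟩ := exp_eq_one_iff.mp h
  have him : w.im = n * (2 * π) := by rw [hn]; simp
  have hn0 : n ≠ 0 := by rintro rfl; simp at hn; exact h0 hn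
  rw [him, abs_mul, abs_of_pos Real.two_pi_pos] at hw
  have h1 : (1 : ℝ) ≤ |(n : ℝ)| := by exact_mod_cast Int.one_le_abs hn0
  nlinarith [Real.pi_pos]

theorem expQuot_ne_zero {w : ℂ} (hw : |w.im| < 2 * π) : expQuot w ≠ 0 := by
  rcases eq_or_ne w 0 with rfl | h0
  · simp [expQuot_zero]
  · rw [expQuot_of_ne h0]
    exact div_ne_zero (sub_ne_zero.mpr (exp_ne_one_of_im_lt hw h0)) h0

theorem bernKer_zero : bernKer 0 = 1 / 2 := by
  rw [bernKer, dslope_same, deriv_expQuot_zero, expQuot_zero]; simp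

theorem bernKer_of_ne {w : ℂ} (hw : |w.im| < 2 * π) (h0 : w ≠ 0) :
    bernKer w = 1 / w + 1 / (1 - exp w) := by
  have h1 := sub_ne_zero.mpr (exp_ne_one_of_im_lt hw h0)
  have h2 := sub_ne_zero.mpr (exp_ne_one_of_im_lt hw h0).symm
  rw [bernKer, dslope_of_ne _ h0, slope_def_field, expQuot_of_ne h0, expQuot_zero]
  field_simp
  ring

theorem bernKer_mul (w : ℂ) (hw : |w.im| < 2 * π) : bernKer w * (1 - exp w) = 1 - expQuot w := by
  rcases eq_or_ne w 0 with rfl | h0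
  · simp [expQuot_zero]
  · have h2 := sub_ne_zero.mpr (exp_ne_one_of_im_lt hw h0).symm
    rw [bernKer_of_ne hw h0, expQuot_of_ne h0]
    field_simp
    ring

theorem isOpen_strip : IsOpen {w : ℂ | |w.im| < 2 * π} :=
  isOpen_lt (continuous_abs.comp continuous_im) continuous_const

theorem differentiableOn_bernKer : DifferentiableOn ℂ bernKer {w : ℂ | |w.im| < 2 * π} := by
  have : Differentiable ℂ (dslope expQuot 0) := by
    rw [← differentiableOn_univ, differentiableOn_dslope univ_mem]
    exact differentiable_expQuot.differentiableOn
  exact this.differentiableOn.div differentiable_expQuot.differentiableOn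
    fun w hw => expQuot_ne_zero hw

theorem im_lt_of_mem_halfStrip {w : ℂ} (hw : w ∈ halfStrip) : |w.im| < 2 * π :=
  hw.2.trans_lt (by linarith [Real.pi_pos])

theorem continuousOn_bernKer : ContinuousOn bernKer halfStrip :=
  differentiableOn_bernKer.continuousOn.mono fun _ => im_lt_of_mem_halfStrip

theorem convex_halfStrip : Convex ℝ halfStrip := by
  have : halfStrip = {w : ℂ | w.re ≤ π} ∩ ({w : ℂ | w.im ≤ π} ∩ {w : ℂ | -π ≤ w.im}) := by
    ext w; simp only [halfStrip, Set.mem_ofPred_eq, abs_le, Set.mem_inter_iff]; tauto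
  rw [this]
  exact (convex_halfSpace_re_le π).inter
    ((convex_halfSpace_im_le π).inter (convex_halfSpace_im_ge (-π)))

theorem mem_halfStrip_of_norm_le {w : ℂ} (hw : ‖w‖ ≤ π) : w ∈ halfStrip :=
  ⟨(re_le_norm w).trans hw, (abs_im_le_norm w).trans hw⟩

theorem neg_ofReal_mem_halfStrip {t : ℝ} (ht : 0 ≤ t) : (-(t : ℂ)) ∈ halfStrip := by
  constructor
  · simp; linarith [Real.pi_pos]
  · simp [Real.pi_pos.le]

theorem norm_one_sub_exp_ge {w : ℂ} (hw : w.re ≤ -1) : 1 / 2 ≤ ‖1 - exp w‖ := by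
  have h1 : ‖exp w‖ ≤ 1 / 2 := by
    rw [norm_exp]
    refine (Real.exp_le_exp.mpr hw).trans ?_
    have := Real.exp_one_gt_d9
    rw [Real.exp_neg, inv_eq_one_div]
    gcongr; linarith
  have := norm_sub_norm_le (1 : ℂ) (exp w)
  rw [norm_one] at this
  linarith

/-- `bernKer` is bounded and Lipschitz on the closed half strip. -/
theorem exists_bernKer_bound : ∃ C : ℝ, 0 ≤ C ∧ (∀ w ∈ halfStrip, ‖bernKer w‖ ≤ C) ∧
    ∀ w ∈ halfStrip, ∀ w' ∈ halfStrip, ‖bernKer w - bernKer w'‖ ≤ C * ‖w - w'‖ := by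
  have hcpt : IsCompact (Set.Icc (-1) π ×ℂ Set.Icc (-π) π) :=
    isCompact_Icc.reProdIm isCompact_Icc
  have hsub : Set.Icc (-1) π ×ℂ Set.Icc (-π) π ⊆ {w : ℂ | |w.im| < 2 * π} := by
    intro w hw
    rw [mem_reProdIm] at hw
    exact (abs_le.mpr hw.2).trans_lt (by linarith [Real.pi_pos])
  obtain ⟨C₁, h₁⟩ := hcpt.exists_bound_of_continuousOn
    (differentiableOn_bernKer.continuousOn.mono hsub)
  obtain ⟨C₂, h₂⟩ := hcpt.exists_bound_of_continuousOn
    ((differentiableOn_bernKer.deriv isOpen_strip).continuousOn.mono hsub)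
  have hmem : ∀ w ∈ halfStrip, -1 ≤ w.re → w ∈ Set.Icc (-1) π ×ℂ Set.Icc (-π) π :=
    fun w hw h => mem_reProdIm.mpr ⟨⟨h, hw.1⟩, abs_le.mp hw.2⟩
  have hne : ∀ w : ℂ, w.re ≤ -1 → w ≠ 0 := by
    rintro w hw rfl; simp at hw; linarith
  have hinv : ∀ w : ℂ, w.re ≤ -1 → ‖w‖⁻¹ ≤ 1 := by
    intro w hw
    refine inv_le_one_of_one_le₀ ((le_abs.mpr (Or.inr (by linarith))).trans (abs_re_le_norm w))
  have hinv' : ∀ w : ℂ, w.re ≤ -1 → ‖1 - exp w‖⁻¹ ≤ 2 := by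
    intro w hw
    have := norm_one_sub_exp_ge hw
    rw [inv_eq_one_div, div_le_iff₀ (by linarith)]; linarith
  have hexp : ∀ w : ℂ, w.re ≤ -1 → ‖exp w‖ ≤ 1 := by
    intro w hw
    rw [norm_exp, Real.exp_le_one_iff]; linarith
  -- For Re w ≤ -1 the two terms of b' have norm at most 1 and 2², whence 5; the compact rectangle
  -- covers the rest.
  have hd : ∀ w ∈ halfStrip, ‖deriv bernKer w‖ ≤ max C₂ 5 := by
    intro w hw
    rcases le_total (-1) w.re with h | h
    · exact (h₂ w (hmem w hw h)).trans (le_max_left _ _)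
    refine le_trans ?_ (le_max_right _ _)
    have h0 := hne w h
    have him := im_lt_of_mem_halfStrip hw
    have h1 := sub_ne_zero.mpr (exp_ne_one_of_im_lt him h0).symm
    have he : bernKer =ᶠ[𝓝 w] fun w => w⁻¹ + (1 - exp w)⁻¹ := by
      filter_upwards [isOpen_strip.mem_nhds him, isOpen_ne.mem_nhds h0] with v hv hv0
      rw [bernKer_of_ne hv hv0, one_div, one_div]
    have hder : HasDerivAt (fun w => w⁻¹ + (1 - exp w)⁻¹)
        (-(w ^ 2)⁻¹ + -(-exp w) / (1 - exp w) ^ 2) w :=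
      (hasDerivAt_inv h0).add (((hasDerivAt_exp w).const_sub 1).inv h1)
    rw [he.deriv_eq, hder.deriv, neg_neg]
    refine (norm_add_le _ _).trans ?_
    rw [norm_neg, norm_inv, norm_pow, norm_div, norm_pow, ← inv_pow, div_eq_mul_inv, ← inv_pow]
    have a1 : (‖w‖⁻¹) ^ 2 ≤ 1 := pow_le_one₀ (by positivity) (hinv w h)
    have a2 : (‖1 - exp w‖⁻¹) ^ 2 ≤ 2 ^ 2 := pow_le_pow_left₀ (by positivity) (hinv' w h) 2
    have a3 : ‖exp w‖ * (‖1 - exp w‖⁻¹) ^ 2 ≤ 1 * 2 ^ 2 :=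
      mul_le_mul (hexp w h) a2 (by positivity) zero_le_one
    linarith
  refine ⟨max (max C₁ 3) (max C₂ 5), ?_, ?_, ?_⟩
  · exact le_max_of_le_right (le_max_of_le_right (by norm_num))
  · intro w hw
    rcases le_total (-1) w.re with h | h
    · exact (h₁ w (hmem w hw h)).trans (le_max_of_le_left (le_max_left _ _))
    refine le_trans ?_ (le_max_of_le_left (le_max_right _ _))
    rw [bernKer_of_ne (im_lt_of_mem_halfStrip hw) (hne w h)]
    refine (norm_add_le _ _).trans ?_
    rw [norm_div, norm_div, norm_one, one_div, one_div]
    linarith [hinv w h, hinv' w h]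
  · intro w hw w' hw'
    refine (convex_halfStrip.norm_image_sub_le_of_norm_deriv_le (f := bernKer) (C := max C₂ 5)
      (fun x hx => differentiableOn_bernKer.differentiableAt
        (isOpen_strip.mem_nhds (im_lt_of_mem_halfStrip hx))) hd hw' hw).trans ?_
    exact mul_le_mul_of_nonneg_right (le_max_right _ _) (norm_nonneg _)

theorem norm_exp_sub_exp_le {a b : ℂ} {m : ℝ} (ha : a.re ≤ m) (hb : b.re ≤ m) :
    ‖exp a - exp b‖ ≤ Real.exp m * ‖a - b‖ := by
  refine (convex_halfSpace_re_le m).norm_image_sub_le_of_norm_deriv_le (f := exp)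
    (fun x _ => differentiable_exp x) (fun x hx => ?_) hb ha
  rw [Complex.deriv_exp, norm_exp]
  exact Real.exp_le_exp.mpr hx

/-- `expQuot` is the average of e^{wu} over u in [0, 1], and 0 ≤ m keeps the real part of each uw
below m. -/
theorem norm_expQuot_sub_le {a b : ℂ} {m : ℝ} (hm : 0 ≤ m) (ha : a.re ≤ m) (hb : b.re ≤ m) :
    ‖expQuot a - expQuot b‖ ≤ Real.exp m * ‖a - b‖ := by
  have hi : ∀ c : ℂ, IntervalIntegrable (fun u : ℝ => exp (c * u)) MeasureTheory.volume 0 1 :=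
    fun c => (by fun_prop : Continuous fun u : ℝ => exp (c * u)).intervalIntegrable _ _
  rw [expQuot_eq_integral, expQuot_eq_integral, ← intervalIntegral.integral_sub (hi a) (hi b)]
  have := intervalIntegral.norm_integral_le_of_norm_le_const (a := 0) (b := 1)
    (C := Real.exp m * ‖a - b‖) (f := fun u : ℝ => exp (a * u) - exp (b * u)) ?_
  · simpa using this
  intro u hu
  rw [Set.uIoc_of_le zero_le_one] at hu
  have key : ∀ c : ℂ, c.re ≤ m → (c * (u : ℂ)).re ≤ m := by
    intro c hc
    rw [re_mul_ofReal]
    nlinarith [hu.1, hu.2]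
  refine (norm_exp_sub_exp_le (key a ha) (key b hb)).trans ?_
  rw [← sub_mul, norm_mul, norm_real, Real.norm_of_nonneg hu.1.le]
  gcongr
  exact mul_le_of_le_one_right (norm_nonneg _) hu.2

/-- The real part is at most π (Re y + |Im y|) ≤ √2 π ‖y‖. The rational 3/2 replaces √2, and 3π/2 is
still below 2π. -/
theorem re_mul_le_of_mem_halfStrip {y w : ℂ} (hy : 0 ≤ y.re) (hw : w ∈ halfStrip) :
    (y * w).re ≤ 3 / 2 * π * ‖y‖ := by
  obtain ⟨h1, h2⟩ := hw
  have hn : ‖y‖ ^ 2 = y.re ^ 2 + y.im ^ 2 := by rw [Complex.sq_norm, normSq_apply]; ring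
  have h3 : y.re + |y.im| ≤ 3 / 2 * ‖y‖ := by
    refine le_of_abs_le (abs_le_of_sq_le_sq (b := 3 / 2 * ‖y‖) ?_ (by positivity))
    nlinarith [sq_nonneg (y.re - |y.im|), sq_abs y.im, norm_nonneg y]
  have h4 : -(y.im * w.im) ≤ |y.im| * π := by
    refine (neg_le_abs _).trans ?_
    rw [abs_mul]; gcongr
  rw [mul_re]
  nlinarith [Real.pi_pos]

/-- `expRem y` is Lipschitz on the half strip, with constant of exponential growth in `y`. -/
theorem exists_expRem_lipschitz : ∃ C : ℝ, 0 ≤ C ∧ ∀ y : ℂ, 0 ≤ y.re →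
    ∀ w ∈ halfStrip, ∀ w' ∈ halfStrip, ‖expRem y w - expRem y w'‖ ≤
      C * ((1 + ‖y‖) ^ 2 * Real.exp (3 / 2 * π * ‖y‖)) * ‖w - w'‖ := by
  obtain ⟨C, hC, hb, hl⟩ := exists_bernKer_bound
  refine ⟨C + 1, by positivity, fun y hy w hw w' hw' => ?_⟩
  set m := 3 / 2 * π * ‖y‖ with hm
  have hm0 : 0 ≤ m := by positivity
  have h1 := re_mul_le_of_mem_halfStrip hy hw
  have h2 := re_mul_le_of_mem_halfStrip hy hw'
  have e : expRem y w - expRem y w' = exp (y * w) * (bernKer w - bernKer w') +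
      (exp (y * w) - exp (y * w')) * bernKer w' -
      y * (expQuot (y * w) - expQuot (y * w')) := by
    simp only [expRem]; ring
  have hsub : ‖y * w - y * w'‖ = ‖y‖ * ‖w - w'‖ := by rw [← mul_sub, norm_mul]
  have b1 : ‖exp (y * w) * (bernKer w - bernKer w')‖ ≤ Real.exp m * (C * ‖w - w'‖) := by
    rw [norm_mul, norm_exp]
    gcongr
    exact hl w hw w' hw'
  have b2 : ‖(exp (y * w) - exp (y * w')) * bernKer w'‖ ≤
      Real.exp m * (‖y‖ * ‖w - w'‖) * C := by
    rw [norm_mul, ← hsub]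
    gcongr
    · exact norm_exp_sub_exp_le h1 h2
    · exact hb w' hw'
  have b3 : ‖y * (expQuot (y * w) - expQuot (y * w'))‖ ≤
      ‖y‖ * (Real.exp m * (‖y‖ * ‖w - w'‖)) := by
    rw [norm_mul, ← hsub]
    gcongr
    exact norm_expQuot_sub_le hm0 h1 h2
  rw [e]
  refine (norm_sub_le _ _).trans ((add_le_add (norm_add_le _ _) le_rfl).trans ?_)
  have hE : 0 ≤ Real.exp m * ‖w - w'‖ := by positivity
  have hy0 := norm_nonneg y
  have : C + C * ‖y‖ + ‖y‖ ^ 2 ≤ (C + 1) * (1 + ‖y‖) ^ 2 := by nlinarith [mul_nonneg hC hy0, mul_nonneg hC (sq_nonneg ‖y‖)]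
  nlinarith [mul_le_mul_of_nonneg_right this hE]

theorem expRem_of_ne {w : ℂ} (y : ℂ) (hw : |w.im| < 2 * π) (h0 : w ≠ 0) :
    expRem y w = exp (y * w) / (1 - exp w) + 1 / w := by
  have h2 := sub_ne_zero.mpr (exp_ne_one_of_im_lt hw h0).symm
  have h3 : y * expQuot (y * w) = (exp (y * w) - 1) / w := by
    rw [← mul_expQuot]; field_simp
  rw [expRem, bernKer_of_ne hw h0, h3]
  field_simp
  ring

theorem expRem_zero_left (w : ℂ) : expRem 0 w = bernKer w := by simp [expRem]

theorem expRem_sub (y : ℂ) {w : ℂ} (hw : |w.im| < 2 * π) :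
    expRem y w - expRem (y + 1) w = exp (y * w) := by
  rcases eq_or_ne w 0 with rfl | h0
  · simp [expRem, expQuot_zero]
  · have h2 := sub_ne_zero.mpr (exp_ne_one_of_im_lt hw h0).symm
    rw [expRem_of_ne y hw h0, expRem_of_ne _ hw h0, add_mul, one_mul, exp_add]
    field_simp
    ring

theorem continuous_expRem_left (w : ℂ) : Continuous fun y => expRem y w := by
  have := continuous_expQuot
  unfold expRem
  fun_prop

theorem differentiable_expRem_left (w : ℂ) : Differentiable ℂ fun y => expRem y w := by
  have := differentiable_expQuot
  unfold expRem
  fun_prop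

theorem ContinuousOn.expRem {α : Type*} [TopologicalSpace α] {f g : α → ℂ} {s : Set α}
    (hf : ContinuousOn f s) (hg : ContinuousOn g s) (hs : ∀ a ∈ s, g a ∈ halfStrip) :
    ContinuousOn (fun a => expRem (f a) (g a)) s := by
  have h1 := continuous_expQuot
  have h2 : ContinuousOn (fun a => bernKer (g a)) s := continuousOn_bernKer.comp hg hs
  have h3 : ContinuousOn (fun a => expQuot (f a * g a)) s := h1.comp_continuousOn (hf.mul hg)
  unfold _root_.expRem
  exact ((hf.mul hg).cexp.mul h2).sub (hf.mul h3)

/-- For w ≠ 0 the mean of e^{yw} is (e^w - 1)/w, so the first term contributes -1/w; at w = 0 the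
kernel is 1/2 - y. -/
theorem integral_expRem {w : ℂ} (hw : |w.im| < 2 * π) :
    ∫ y in (0 : ℝ)..1, expRem y w = 0 := by
  rcases eq_or_ne w 0 with rfl | h0
  · have : ∀ y : ℝ, expRem y 0 = 1 / 2 - y := by
      intro y; simp [expRem, expQuot_zero, bernKer_zero]
    simp only [this]
    rw [intervalIntegral.integral_sub (by simp)
      (continuous_ofReal.intervalIntegrable _ _), intervalIntegral.integral_ofReal]
    simp
  · have h2 := sub_ne_zero.mpr (exp_ne_one_of_im_lt hw h0).symm
    simp only [expRem_of_ne _ hw h0]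
    have hc : Continuous fun y : ℝ => exp ((y : ℂ) * w) / (1 - exp w) := by fun_prop
    rw [intervalIntegral.integral_add (hc.intervalIntegrable _ _) (by simp),
      intervalIntegral.integral_div]
    simp only [mul_comm _ w]
    rw [integral_exp_mul_complex h0]
    simp
    field_simp
    ring

end Kernel

/-! ### Holomorphy of parametric integrals. -/

section Parametric

open Filter Complex MeasureTheory Metric

/-- A locally bounded integral of holomorphic functions is holomorphic. -/
theorem differentiableAt_integral_of_norm_le {α : Type*} [MeasurableSpace α] {μ : Measure α}
    {F : ℂ → α → ℂ} {y₀ : ℂ} {r : ℝ} (hr : 0 < r) {bound : α → ℝ}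
    (hmeas : ∀ y ∈ ball y₀ r, AEStronglyMeasurable (F y) μ)
    (hbd : ∀ᵐ a ∂μ, ∀ y ∈ ball y₀ r, ‖F y a‖ ≤ bound a) (hint : Integrable bound μ)
    (hdiff : ∀ᵐ a ∂μ, DifferentiableOn ℂ (F · a) (ball y₀ r)) :
    DifferentiableAt ℂ (fun y => ∫ a, F y a ∂μ) y₀ := by
  have hy₀ : y₀ ∈ ball y₀ r := mem_ball_self hr
  have hder : ∀ᵐ a ∂μ, ∀ y ∈ ball y₀ (r / 2), HasDerivAt (F · a) (deriv (F · a) y) y := by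
    filter_upwards [hdiff] with a ha y hy
    exact (ha.differentiableAt (isOpen_ball.mem_nhds
      (ball_subset_ball (by linarith) hy))).hasDerivAt
  refine (hasDerivAt_integral_of_dominated_loc_of_deriv_le (s := ball y₀ (r / 2))
    (bound := fun a => bound a / (r / 4)) (F' := fun y a => deriv (F · a) y)
    (ball_mem_nhds _ (by positivity)) ?_ ?_ ?_ ?_ (hint.div_const _) hder).2.differentiableAt
  · filter_upwards [ball_mem_nhds y₀ hr] with y hy using hmeas y hy
  · exact hint.mono' (hmeas _ hy₀) (hbd.mono fun a ha => ha _ hy₀)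
  -- Difference quotients along this sequence converge to the derivative at y₀, which makes that
  -- derivative measurable in the parameter.
  · set u : ℕ → ℂ := fun n => y₀ + ((r / (n + 2) : ℝ) : ℂ) with hu
    have hlt : ∀ n : ℕ, r / ((n : ℝ) + 2) < r := fun n =>
      div_lt_self hr (by have : (0 : ℝ) ≤ n := n.cast_nonneg
                         linarith)
    have hpos : ∀ n : ℕ, 0 < r / ((n : ℝ) + 2) := fun n => by positivity
    have hum : ∀ n, u n ∈ ball y₀ r := by
      intro n
      rw [mem_ball, dist_eq_norm, hu]
      simp only [add_sub_cancel_left, norm_real, Real.norm_of_nonneg (hpos n).le]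
      exact hlt n
    have hune : ∀ n, u n ≠ y₀ := by
      intro n h
      rw [hu] at h
      simp only [add_eq_left, ofReal_eq_zero] at h
      exact (hpos n).ne' h
    have hut : Tendsto u atTop (𝓝[≠] y₀) := by
      refine tendsto_nhdsWithin_iff.mpr ⟨?_, Eventually.of_forall hune⟩
      have h1 : Tendsto (fun n : ℕ => r / ((n : ℝ) + 2)) atTop (𝓝 0) :=
        tendsto_const_nhds.div_atTop
          (tendsto_atTop_add_const_right _ _ tendsto_natCast_atTop_atTop)
      have h2 := ((continuous_ofReal.tendsto 0).comp h1).const_add y₀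
      simpa [hu] using h2
    refine aestronglyMeasurable_of_tendsto_ae atTop (f := fun n a => slope (F · a) y₀ (u n))
      (fun n => ?_) ?_
    · simp only [slope_def_field]
      simp only [div_eq_mul_inv]
      exact ((hmeas _ (hum n)).sub (hmeas _ hy₀)).mul aestronglyMeasurable_const
    · filter_upwards [hder] with a ha
      exact (hasDerivAt_iff_tendsto_slope.mp (ha y₀ (mem_ball_self (by positivity)))).comp hut
  · filter_upwards [hbd, hdiff] with a ha hd y hy
    -- Cauchy's estimate on the circle of radius r/4 about y bounds the derivative by `bound a / (r
    -- / 4)`.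
    have hsub : closedBall y (r / 4) ⊆ ball y₀ r := by
      intro x hx
      rw [mem_closedBall] at hx
      rw [mem_ball] at hy ⊢
      linarith [dist_triangle x y y₀]
    refine norm_deriv_le_of_forall_mem_sphere_norm_le (by positivity) ?_
      fun x hx => ha x (hsub (sphere_subset_closedBall hx))
    exact DifferentiableOn.diffContOnCl_ball hd hsub

end Parametric

/-! ### The bent path and Frullani's integral along it. -/

section Ray

open Filter Complex MeasureTheory Set

/-- Displacement from `z` along the path going from `z` straight to `0` and then to `-∞`. -/
noncomputable def rayDisp (z : ℂ) (t : ℝ) : ℂ := z * (min t 1 : ℝ) + (max (t - 1) 0 : ℝ)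

/-- Derivative of `rayDisp z`. -/
noncomputable def rayVel (z : ℂ) (t : ℝ) : ℂ := if t ≤ 1 then z else 1

theorem rayDisp_of_le {z : ℂ} {t : ℝ} (ht : t ≤ 1) : rayDisp z t = z * t := by
  rw [rayDisp, min_eq_left ht, max_eq_right (by linarith)]; simp

theorem rayDisp_of_ge {z : ℂ} {t : ℝ} (ht : 1 ≤ t) : rayDisp z t = z + (t - 1) := by
  rw [rayDisp, min_eq_right ht, max_eq_left (by linarith)]; simp

theorem continuous_rayDisp (z : ℂ) : Continuous (rayDisp z) := by
  unfold rayDisp; fun_prop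

theorem measurable_rayVel (z : ℂ) : Measurable (rayVel z) :=
  Measurable.ite measurableSet_Iic measurable_const measurable_const

variable {z : ℂ}

theorem norm_rayVel_le (hz : ‖z‖ ≤ π) (t : ℝ) : ‖rayVel z t‖ ≤ π := by
  rw [rayVel]; split_ifs
  · exact hz
  · simp; linarith [Real.pi_gt_three]

theorem sub_rayDisp_mem (hz : ‖z‖ ≤ π) {t : ℝ} (ht : 0 ≤ t) : z - rayDisp z t ∈ halfStrip := by
  rcases le_total t 1 with h | h
  · rw [rayDisp_of_le h]
    refine mem_halfStrip_of_norm_le ?_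
    have : z - z * t = ((1 - t : ℝ) : ℂ) * z := by push_cast; ring
    rw [this, norm_mul, norm_real, Real.norm_of_nonneg (by linarith)]
    exact (mul_le_of_le_one_left (norm_nonneg _) (by linarith)).trans hz
  · rw [rayDisp_of_ge h]
    have : z - (z + (t - 1)) = -((t - 1 : ℝ) : ℂ) := by push_cast; ring
    rw [this]
    exact neg_ofReal_mem_halfStrip (by linarith)

theorem norm_exp_neg_mul_rayDisp_le (hz : ‖z‖ ≤ π) {x : ℂ} (hx : 0 ≤ x.re) {t : ℝ} (ht : 0 ≤ t) :
    ‖exp (-x * rayDisp z t)‖ ≤ Real.exp (‖x‖ * π + x.re) * Real.exp (-x.re * t) := by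
  rw [norm_exp, ← Real.exp_add]
  apply Real.exp_le_exp.mpr
  have h1 : -(x * z).re ≤ ‖x‖ * π := by
    refine (neg_le_abs _).trans ((abs_re_le_norm _).trans ?_)
    rw [norm_mul]; gcongr
  have h2 : 0 ≤ ‖x‖ * π := by positivity
  rcases le_total t 1 with h | h
  · rw [rayDisp_of_le h, neg_mul, ← mul_assoc, neg_re, re_mul_ofReal]
    nlinarith
  · rw [rayDisp_of_ge h]
    have : -x * (z + (t - 1)) = -(x * z) - x * ((t - 1 : ℝ) : ℂ) := by push_cast; ring
    rw [this, sub_re, neg_re, re_mul_ofReal]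
    nlinarith

theorem norm_exp_sub_rayDisp_le (hz : ‖z‖ ≤ π) {t : ℝ} (ht : 0 ≤ t) :
    ‖exp (z - rayDisp z t)‖ ≤ Real.exp (2 * π + 1) * Real.exp (-t) := by
  have h := norm_exp_neg_mul_rayDisp_le hz (x := 1) (by simp) ht
  have e : z - rayDisp z t = z + -1 * rayDisp z t := by ring
  rw [e, exp_add, norm_mul]
  have h2 : ‖exp z‖ ≤ Real.exp π := by
    rw [norm_exp]; exact Real.exp_le_exp.mpr ((re_le_norm z).trans hz)
  refine (mul_le_mul h2 h (norm_nonneg _) (Real.exp_nonneg _)).trans (le_of_eq ?_)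
  simp only [norm_one, one_mul, one_re, neg_mul, ← Real.exp_add]
  ring_nf

theorem integrableOn_exp_neg_mul {c : ℝ} (hc : 0 < c) (K : ℝ) :
    IntegrableOn (fun t : ℝ => K * Real.exp (-c * t)) (Ioi 0) :=
  (integrableOn_exp_mul_Ioi (neg_lt_zero.mpr hc) 0).const_mul K

/-- The integrand has primitive -e^{-xd}/x along the path, and the displacement d starts at 0 and
goes to +∞; the contributions at the corner d = z cancel. -/
theorem integral_exp_neg_mul_rayVel (hz : ‖z‖ ≤ π) {x : ℂ} (hx : 0 < x.re) :
    ∫ t in Ioi (0 : ℝ), exp (-x * rayDisp z t) * rayVel z t = 1 / x := by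
  have hx0 : x ≠ 0 := by rintro rfl; simp at hx
  have hint : IntegrableOn (fun t : ℝ => exp (-x * rayDisp z t) * rayVel z t) (Ioi 0) := by
    refine Integrable.mono' (integrableOn_exp_neg_mul hx (Real.exp (‖x‖ * π + x.re) * π)) ?_ ?_
    · refine AEStronglyMeasurable.mul ?_ (measurable_rayVel z).aestronglyMeasurable
      have := continuous_rayDisp z
      exact (by fun_prop : Continuous fun t : ℝ => exp (-x * rayDisp z t)).aestronglyMeasurable
    · refine (ae_restrict_mem measurableSet_Ioi).mono fun t ht => ?_
      rw [norm_mul, mul_right_comm]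
      exact mul_le_mul (norm_exp_neg_mul_rayDisp_le hz hx.le ht.le) (norm_rayVel_le hz t)
        (norm_nonneg _) (by positivity)
  rw [← Ioc_union_Ioi_eq_Ioi (zero_le_one' ℝ), setIntegral_union (by
    rw [Set.disjoint_iff]; intro t ht; exact absurd ht.1.2 (not_le.mpr ht.2)) measurableSet_Ioi
    (hint.mono_set Ioc_subset_Ioi_self) (hint.mono_set (Ioi_subset_Ioi zero_le_one))]
  have h1 : ∫ t in Ioc (0 : ℝ) 1, exp (-x * rayDisp z t) * rayVel z t = (1 - exp (-x * z)) / x := by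
    have : ∫ t in Ioc (0 : ℝ) 1, exp (-x * rayDisp z t) * rayVel z t =
        ∫ t in (0 : ℝ)..1, exp (-x * (z * t)) * z := by
      rw [intervalIntegral.integral_of_le zero_le_one]
      refine setIntegral_congr_fun measurableSet_Ioc fun t ht => ?_
      simp only [rayDisp_of_le ht.2, rayVel, if_pos ht.2]
    rw [this]
    have hd : ∀ t ∈ uIcc (0 : ℝ) 1, HasDerivAt (fun t : ℝ => -exp (-x * (z * t)) / x)
        (exp (-x * (z * t)) * z) t := by
      intro t _
      have h := ((((ofRealCLM.hasDerivAt (x := t)).const_mul z).const_mul (-x)).cexp).neg.div_const x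
      refine h.congr_deriv ?_
      simp only [ofRealCLM_apply, ofReal_one]
      field_simp
    rw [intervalIntegral.integral_eq_sub_of_hasDerivAt hd
      ((by fun_prop : Continuous fun t : ℝ => exp (-x * (z * t)) * z).intervalIntegrable _ _)]
    simp; ring
  have h2 : ∫ t in Ioi (1 : ℝ), exp (-x * rayDisp z t) * rayVel z t = exp (-x * z) / x := by
    have : ∫ t in Ioi (1 : ℝ), exp (-x * rayDisp z t) * rayVel z t =
        ∫ t in Ioi (1 : ℝ), exp (-x * (z - 1)) * exp (-x * t) := by
      refine setIntegral_congr_fun measurableSet_Ioi fun t ht => ?_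
      simp only [rayDisp_of_ge (le_of_lt ht), rayVel,
        if_neg (not_le.mpr (mem_Ioi.mp ht)), mul_one,
        ← exp_add]
      congr 1; ring
    rw [this, integral_const_mul, integral_exp_mul_complex_Ioi (by simpa using hx)]
    have : exp (-x * z) = exp (-x * (z - 1)) * exp (-x * (1 : ℝ)) := by
      rw [← exp_add]; congr 1; push_cast; ring
    rw [this]; field_simp
  rw [h1, h2]; ring

/-- Beyond t = 1 the displacement can vanish only at t = 1 - Re z, a null set. On (0, 1] it vanishes
only for z = 0, and then the velocity is 0 too. -/
theorem ae_rayVel_eq_zero : ∀ᵐ t ∂(volume.restrict (Ioi (0 : ℝ))),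
    rayDisp z t = 0 → rayVel z t = 0 := by
  have h1 : ∀ᵐ t : ℝ, t ≠ 1 - z.re := by simp [ae_iff]
  filter_upwards [ae_restrict_mem measurableSet_Ioi, ae_restrict_of_ae h1] with t ht ht1 h
  rcases le_or_gt t 1 with h' | h'
  · rw [rayDisp_of_le h'] at h
    rw [rayVel, if_pos h']
    exact (mul_eq_zero.mp h).resolve_right (by exact_mod_cast (ne_of_gt ht))
  · exfalso
    rw [rayDisp_of_ge h'.le] at h
    have := congrArg re h
    simp at this
    exact ht1 (by linarith)

/-- Frullani's integral for the logarithm, along a bent ray. -/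
theorem integral_frullani_rayDisp (hz : ‖z‖ ≤ π) {x : ℂ} (hx : 0 < x.re) :
    ∫ t in Ioi (0 : ℝ), (exp (-rayDisp z t) - exp (-x * rayDisp z t)) / rayDisp z t *
      rayVel z t = log x := by
  set K : ℂ → ℝ → ℂ := fun x t =>
    (exp (-rayDisp z t) - exp (-x * rayDisp z t)) / rayDisp z t * rayVel z t with hK
  have hv := continuous_rayDisp z
  have hder : ∀ᵐ t ∂(volume.restrict (Ioi (0 : ℝ))), ∀ x : ℂ,
      HasDerivAt (K · t) (exp (-x * rayDisp z t) * rayVel z t) x := by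
    filter_upwards [ae_rayVel_eq_zero (z := z)] with t ht x
    rcases eq_or_ne (rayDisp z t) 0 with h0 | h0
    · simp only [hK, ht h0, mul_zero]
      exact hasDerivAt_const x (0 : ℂ)
    · have h := ((((hasDerivAt_neg x).mul_const (rayDisp z t)).cexp.const_sub
        (exp (-rayDisp z t))).div_const (rayDisp z t)).mul_const (rayVel z t)
      refine h.congr_deriv ?_
      field_simp
  have hmeas : ∀ x, AEStronglyMeasurable (K x) (volume.restrict (Ioi (0 : ℝ))) := by
    intro x
    have h1 : Measurable fun t : ℝ => exp (-rayDisp z t) - exp (-x * rayDisp z t) :=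
      (by fun_prop : Continuous fun t : ℝ =>
        exp (-rayDisp z t) - exp (-x * rayDisp z t)).measurable
    exact ((h1.div hv.measurable).mul (measurable_rayVel z)).aestronglyMeasurable
  have hmeas' : ∀ x : ℂ, AEStronglyMeasurable (fun t => exp (-x * rayDisp z t) * rayVel z t)
      (volume.restrict (Ioi (0 : ℝ))) := by
    intro x
    exact ((by fun_prop : Continuous fun t : ℝ => exp (-x * rayDisp z t)).measurable.mul
      (measurable_rayVel z)).aestronglyMeasurable
  have hbd : ∀ (ε B : ℝ) (x : ℂ), 0 ≤ ε → ε ≤ x.re → ‖x‖ ≤ B → ∀ t ∈ Ioi (0 : ℝ),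
      ‖exp (-x * rayDisp z t) * rayVel z t‖ ≤
        Real.exp (B * π + B) * π * Real.exp (-ε * t) := by
    intro ε B x hε hεx hB t ht
    rw [norm_mul, mul_right_comm]
    refine mul_le_mul ((norm_exp_neg_mul_rayDisp_le hz (hε.trans hεx) (le_of_lt ht)).trans ?_)
      (norm_rayVel_le hz t) (norm_nonneg _) (by positivity)
    have : x.re ≤ B := (re_le_norm x).trans hB
    have ht' : 0 ≤ t := le_of_lt ht
    gcongr
  have hK1 : ∀ t, K 1 t = 0 := by intro t; simp [hK]
  have hint : ∀ x : ℂ, 0 < x.re → IntegrableOn (K x) (Ioi 0) := by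
    intro x hx
    -- These values put both 1 and x in the convex region below; the mean value inequality from 1,
    -- where the kernel vanishes, then dominates `K x`.
    set ε := min 1 x.re
    set B := max 1 ‖x‖
    have hε : 0 < ε := lt_min one_pos hx
    have hconv : Convex ℝ ({y : ℂ | ε ≤ y.re} ∩ Metric.closedBall 0 B) :=
      (convex_halfSpace_re_ge ε).inter (convex_closedBall _ _)
    refine Integrable.mono' (integrableOn_exp_neg_mul hε
      (Real.exp (B * π + B) * π * ‖x - 1‖)) (hmeas x) ?_
    filter_upwards [ae_restrict_mem measurableSet_Ioi, hder] with t ht hd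
    have := hconv.norm_image_sub_le_of_norm_hasDerivWithin_le (f := (K · t))
      (C := Real.exp (B * π + B) * π * Real.exp (-ε * t))
      (fun y _ => (hd y).hasDerivWithinAt)
      (fun y hy => hbd ε B y hε.le hy.1 (by simpa using hy.2) t ht)
      (x := 1) (y := x) ⟨by simp [ε], by simp [B]⟩ ⟨by simp [ε], by simp [B]⟩
    simp only [hK1, sub_zero] at this
    refine this.trans (le_of_eq (by ring))
  have hΦ : ∀ x : ℂ, 0 < x.re →
      HasDerivAt (fun x => ∫ t in Ioi (0 : ℝ), K x t) (1 / x) x := by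
    intro x hx
    rw [← integral_exp_neg_mul_rayVel hz hx]
    have hs : {y : ℂ | x.re / 2 < y.re} ∩ Metric.ball 0 (‖x‖ + 1) ∈ 𝓝 x := by
      refine inter_mem ((isOpen_lt continuous_const continuous_re).mem_nhds ?_)
        (Metric.isOpen_ball.mem_nhds (by simp))
      simp only [mem_ofPred_eq]; linarith
    refine (hasDerivAt_integral_of_dominated_loc_of_deriv_le
      (F' := fun x t => exp (-x * rayDisp z t) * rayVel z t) hs
      (Eventually.of_forall hmeas) (hint x hx) (hmeas' x) ?_
      (integrableOn_exp_neg_mul (c := x.re / 2) (by positivity)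
        (Real.exp ((‖x‖ + 1) * π + (‖x‖ + 1)) * π)) ?_).2
    · filter_upwards [ae_restrict_mem measurableSet_Ioi] with t ht y hy
      exact hbd (x.re / 2) (‖x‖ + 1) y (by positivity) hy.1.le
        (le_of_lt (by simpa using hy.2)) t ht
    · filter_upwards [hder] with t ht y _ using ht y
  have hlog : ∀ x : ℂ, 0 < x.re → HasDerivAt log (1 / x) x := by
    intro x hx
    rw [one_div]
    exact hasDerivAt_log (Or.inl hx)
  have hopen : IsOpen {x : ℂ | 0 < x.re} := isOpen_lt continuous_const continuous_re
  -- Both functions have derivative 1/x on the half-plane and vanish at 1.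
  refine hopen.eqOn_of_deriv_eq (convex_halfSpace_re_gt 0).isPreconnected (g := log)
    (fun x hx => (hΦ x hx).differentiableAt.differentiableWithinAt)
    (fun x hx => (hlog x hx).differentiableAt.differentiableWithinAt)
    (fun x hx => (hΦ x hx).deriv.trans (hlog x hx).deriv.symm)
    (x := 1) (by simp) ?_ hx
  simp [hK1]

end Ray

/-! ### The Ramanujan remainder of e^{xz} log x and its value at 1. -/

section Remainder

open Filter Complex MeasureTheory Set

/-- The integrand of `rayRem`. -/
noncomputable def rayKer (z y : ℂ) (t : ℝ) : ℂ :=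
  exp (z - rayDisp z t) * ((expRem y z - expRem y (z - rayDisp z t)) / rayDisp z t) * rayVel z t

/-- The part of the Ramanujan remainder of `e^{xz} log x`, at `x = y + 1`, given by an integral along
the path from `z` to `0` to `-∞`. -/
noncomputable def rayRem (z y : ℂ) : ℂ := ∫ t in Ioi (0 : ℝ), rayKer z y t

/-- The Lipschitz bound on E_y cancels the denominator `rayDisp z t`; the decay in t comes from the
factor e^{z - d}. -/
theorem exists_rayKer_bound : ∃ C : ℝ, 0 ≤ C ∧ ∀ z : ℂ, ‖z‖ ≤ π → ∀ y : ℂ, 0 ≤ y.re →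
    ∀ t ∈ Ioi (0 : ℝ), ‖rayKer z y t‖ ≤
      C * ((1 + ‖y‖) ^ 2 * Real.exp (3 / 2 * π * ‖y‖)) * Real.exp (-1 * t) := by
  obtain ⟨C, hC, hl⟩ := exists_expRem_lipschitz
  refine ⟨Real.exp (2 * π + 1) * C * π, by positivity, fun z hz y hy t ht => ?_⟩
  have ht0 : 0 ≤ t := le_of_lt ht
  set L := (1 + ‖y‖) ^ 2 * Real.exp (3 / 2 * π * ‖y‖)
  have h1 : ‖(expRem y z - expRem y (z - rayDisp z t)) / rayDisp z t‖ ≤ C * L := by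
    rw [norm_div]
    refine div_le_of_le_mul₀ (norm_nonneg _) (by positivity) ?_
    have := hl y hy z (mem_halfStrip_of_norm_le hz) _ (sub_rayDisp_mem hz ht0)
    rwa [sub_sub_cancel] at this
  rw [rayKer, norm_mul, norm_mul]
  refine (mul_le_mul (mul_le_mul (norm_exp_sub_rayDisp_le hz ht0) h1 (norm_nonneg _)
    (by positivity)) (norm_rayVel_le hz t) (norm_nonneg _) (by positivity)).trans (le_of_eq ?_)
  rw [neg_one_mul]; ring

variable {z : ℂ}

theorem aestronglyMeasurable_rayKer_prod (hz : ‖z‖ ≤ π) {s : Set ℝ} (hs : MeasurableSet s) :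
    AEStronglyMeasurable (Function.uncurry fun (y : ℝ) t => rayKer z y t)
      ((volume.restrict s).prod (volume.restrict (Ioi (0 : ℝ)))) := by
  rw [Measure.prod_restrict]
  have hv := continuous_rayDisp z
  have h1 : ContinuousOn (fun p : ℝ × ℝ => expRem p.1 (z - rayDisp z p.2)) (s ×ˢ Ioi (0 : ℝ)) := by
    exact ContinuousOn.expRem (continuous_ofReal.comp continuous_fst).continuousOn
      (continuous_const.sub (hv.comp continuous_snd)).continuousOn
      fun p hp => sub_rayDisp_mem hz (le_of_lt hp.2)
  have h2 : Continuous (fun p : ℝ × ℝ => expRem p.1 z) :=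
    (continuous_expRem_left z).comp (by fun_prop)
  have h3 : AEStronglyMeasurable (fun p : ℝ × ℝ => expRem p.1 z - expRem p.1 (z - rayDisp z p.2))
      ((volume.prod volume).restrict (s ×ˢ Ioi (0 : ℝ))) :=
    (h2.continuousOn.sub h1).aestronglyMeasurable (hs.prod measurableSet_Ioi)
  have h4 : Measurable fun p : ℝ × ℝ => (rayDisp z p.2)⁻¹ :=
    (hv.comp continuous_snd).measurable.inv
  have h5 : Continuous fun p : ℝ × ℝ => exp (z - rayDisp z p.2) := by fun_prop
  have h6 : Measurable fun p : ℝ × ℝ => rayVel z p.2 := (measurable_rayVel z).comp measurable_snd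
  have e : (Function.uncurry fun (y : ℝ) t => rayKer z y t) = fun p : ℝ × ℝ =>
      exp (z - rayDisp z p.2) * ((expRem p.1 z - expRem p.1 (z - rayDisp z p.2)) *
        (rayDisp z p.2)⁻¹) * rayVel z p.2 := by
    funext p
    simp only [Function.uncurry, rayKer, div_eq_mul_inv]
  rw [e]
  exact (h5.aestronglyMeasurable.mul (h3.mul h4.aestronglyMeasurable)).mul h6.aestronglyMeasurable

theorem aestronglyMeasurable_rayKer (hz : ‖z‖ ≤ π) (y : ℂ) :
    AEStronglyMeasurable (rayKer z y) (volume.restrict (Ioi (0 : ℝ))) := by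
  have hv := continuous_rayDisp z
  have h1 : ContinuousOn (fun t : ℝ => expRem y (z - rayDisp z t)) (Ioi (0 : ℝ)) := by
    exact ContinuousOn.expRem continuousOn_const (continuous_const.sub hv).continuousOn
      fun t ht => sub_rayDisp_mem hz (le_of_lt ht)
  have h3 : AEStronglyMeasurable (fun t : ℝ => expRem y z - expRem y (z - rayDisp z t))
      (volume.restrict (Ioi (0 : ℝ))) :=
    (continuousOn_const.sub h1).aestronglyMeasurable measurableSet_Ioi
  have h4 : Measurable fun t : ℝ => (rayDisp z t)⁻¹ := hv.measurable.inv
  have h5 : Continuous fun t : ℝ => exp (z - rayDisp z t) := by fun_prop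
  have e : rayKer z y = fun t : ℝ => exp (z - rayDisp z t) *
      ((expRem y z - expRem y (z - rayDisp z t)) * (rayDisp z t)⁻¹) * rayVel z t := by
    funext t
    simp only [rayKer, div_eq_mul_inv]
  rw [e]
  exact (h5.aestronglyMeasurable.mul (h3.mul h4.aestronglyMeasurable)).mul
    (measurable_rayVel z).aestronglyMeasurable

theorem integrableOn_rayKer (hz : ‖z‖ ≤ π) {y : ℂ} (hy : 0 ≤ y.re) :
    IntegrableOn (rayKer z y) (Ioi 0) := by
  obtain ⟨C, hC, hb⟩ := exists_rayKer_bound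
  refine Integrable.mono' (integrableOn_exp_neg_mul one_pos
    (C * ((1 + ‖y‖) ^ 2 * Real.exp (3 / 2 * π * ‖y‖)))) (aestronglyMeasurable_rayKer hz y) ?_
  filter_upwards [ae_restrict_mem measurableSet_Ioi] with t ht using hb z hz y hy t ht

theorem exists_rayRem_bound (hz : ‖z‖ ≤ π) : ∃ C : ℝ, 0 ≤ C ∧ ∀ y : ℂ, 0 ≤ y.re →
    ‖rayRem z y‖ ≤ C * ((1 + ‖y‖) ^ 2 * Real.exp (3 / 2 * π * ‖y‖)) := by
  obtain ⟨C, hC, hb⟩ := exists_rayKer_bound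
  refine ⟨C, hC, fun y hy => ?_⟩
  refine (norm_integral_le_of_norm_le (integrableOn_exp_neg_mul one_pos
    (C * ((1 + ‖y‖) ^ 2 * Real.exp (3 / 2 * π * ‖y‖)))) ?_).trans (le_of_eq ?_)
  · filter_upwards [ae_restrict_mem measurableSet_Ioi] with t ht using hb z hz y hy t ht
  · rw [integral_const_mul]
    simp only [neg_one_mul, integral_exp_neg_Ioi_zero, mul_one]

theorem differentiableOn_rayRem (hz : ‖z‖ ≤ π) :
    DifferentiableOn ℂ (rayRem z) rightHalfPlane := by
  obtain ⟨C, hC, hb⟩ := exists_rayKer_bound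
  intro y₀ hy₀
  rw [mem_rightHalfPlane] at hy₀
  have hball : ∀ y ∈ Metric.ball y₀ y₀.re, 0 ≤ y.re ∧ ‖y‖ ≤ 2 * ‖y₀‖ := by
    intro y hy
    rw [Metric.mem_ball, dist_eq_norm] at hy
    have h1 := (abs_le.mp ((abs_re_le_norm (y - y₀)).trans hy.le)).1
    rw [sub_re] at h1
    have h2 := norm_le_norm_add_norm_sub y₀ y
    rw [norm_sub_rev] at h2
    have h3 := re_le_norm y₀
    exact ⟨by linarith, by linarith⟩
  refine (differentiableAt_integral_of_norm_le hy₀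
    (bound := fun t => C * ((1 + 2 * ‖y₀‖) ^ 2 * Real.exp (3 / 2 * π * (2 * ‖y₀‖))) *
      Real.exp (-1 * t))
    (fun y _ => aestronglyMeasurable_rayKer hz y) ?_ (integrableOn_exp_neg_mul one_pos _)
    (Eventually.of_forall fun t => ?_)).differentiableWithinAt
  · filter_upwards [ae_restrict_mem measurableSet_Ioi] with t ht y hy
    obtain ⟨h1, h2⟩ := hball y hy
    refine (hb z hz y h1 t ht).trans ?_
    gcongr
  · have h1 := differentiable_expRem_left z
    have h2 := differentiable_expRem_left (z - rayDisp z t)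
    unfold rayKer
    exact (by fun_prop : Differentiable ℂ fun y => exp (z - rayDisp z t) *
      ((expRem y z - expRem y (z - rayDisp z t)) / rayDisp z t) * rayVel z t).differentiableOn

/-- The relation E_y - E_{y+1} = e^{yw}, used at w = z and w = z - d, turns the difference of the
kernels into e^{(y+1)z} times Frullani's kernel for y + 1. -/
theorem rayRem_sub (hz : ‖z‖ ≤ π) {y : ℂ} (hy : 0 ≤ y.re) :
    rayRem z y - rayRem z (y + 1) = exp ((y + 1) * z) * log (y + 1) := by
  have hx : 0 < (y + 1).re := by simp; linarith
  rw [rayRem, rayRem, ← integral_sub (integrableOn_rayKer hz hy) (integrableOn_rayKer hz hx.le),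
    ← integral_frullani_rayDisp hz hx, ← integral_const_mul]
  refine setIntegral_congr_fun measurableSet_Ioi fun t ht => ?_
  have h1 := expRem_sub y (im_lt_of_mem_halfStrip (mem_halfStrip_of_norm_le hz))
  have h2 := expRem_sub y (im_lt_of_mem_halfStrip (sub_rayDisp_mem hz (le_of_lt ht)))
  have h3 : exp (z - rayDisp z t) * exp (y * z) = exp ((y + 1) * z) * exp (-rayDisp z t) := by
    rw [← exp_add, ← exp_add]; congr 1; ring
  have h4 : exp (z - rayDisp z t) * exp (y * (z - rayDisp z t)) =
      exp ((y + 1) * z) * exp (-(y + 1) * rayDisp z t) := by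
    rw [← exp_add, ← exp_add]; congr 1; ring
  simp only [rayKer]
  linear_combination (exp (z - rayDisp z t) * rayVel z t / rayDisp z t) * (h1 - h2) +
    rayVel z t / rayDisp z t * (h3 - h4)

/-- Fubini puts the y-integral inside, where both values of E_y have mean zero. -/
theorem integral_rayRem (hz : ‖z‖ ≤ π) : ∫ y in (0 : ℝ)..1, rayRem z y = 0 := by
  obtain ⟨C, hC, hb⟩ := exists_rayKer_bound
  have hswap : Integrable (Function.uncurry fun (y : ℝ) t => rayKer z y t)
      ((volume.restrict (uIoc 0 1)).prod (volume.restrict (Ioi (0 : ℝ)))) := by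
    have hg : Integrable (fun p : ℝ × ℝ =>
        (1 : ℝ) * (C * ((1 + 1) ^ 2 * Real.exp (3 / 2 * π * 1)) * Real.exp (-1 * p.2)))
        ((volume.restrict (uIoc 0 1)).prod (volume.restrict (Ioi (0 : ℝ)))) := by
      refine Integrable.mul_prod (f := fun _ : ℝ => (1 : ℝ)) ?_ (integrableOn_exp_neg_mul one_pos _)
      rw [uIoc_of_le zero_le_one]
      exact integrable_const _
    refine hg.mono' (aestronglyMeasurable_rayKer_prod hz measurableSet_uIoc) ?_
    rw [Measure.prod_restrict]
    filter_upwards [ae_restrict_mem (measurableSet_uIoc.prod measurableSet_Ioi)] with p hp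
    obtain ⟨h1, h2⟩ := hp
    rw [uIoc_of_le zero_le_one] at h1
    have hn : ‖(p.1 : ℂ)‖ ≤ 1 := by rw [norm_real, Real.norm_of_nonneg h1.1.le]; exact h1.2
    refine (hb z hz p.1 (by simpa using h1.1.le) p.2 h2).trans ?_
    rw [one_mul]
    gcongr
  simp only [rayRem]
  rw [intervalIntegral_integral_swap hswap]
  refine setIntegral_eq_zero_of_forall_eq_zero fun t ht => ?_
  have hi : ∀ w, IntervalIntegrable (fun y : ℝ => expRem y w) volume 0 1 := fun w =>
    ((continuous_expRem_left w).comp continuous_ofReal).intervalIntegrable _ _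
  simp only [rayKer, intervalIntegral.integral_mul_const, intervalIntegral.integral_const_mul,
    intervalIntegral.integral_div]
  rw [intervalIntegral.integral_sub (hi _) (hi _),
    integral_expRem (im_lt_of_mem_halfStrip (mem_halfStrip_of_norm_le hz)),
    integral_expRem (im_lt_of_mem_halfStrip (sub_rayDisp_mem hz (le_of_lt ht)))]
  simp

theorem hasExpGrowth_exp_mul_log (z : ℂ) {α : ℝ} (hα : ‖z‖ < α) :
    HasExpGrowth (fun x => exp (x * z) * log x) α := by
  intro δ hδ
  -- The surplus exponent absorbs the logarithm through ‖x‖ ≤ ε⁻¹ e^{ε‖x‖}.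
  set ε := α - ‖z‖ with hε
  have hε0 : 0 < ε := sub_pos.mpr hα
  refine ⟨1 / ε + (|Real.log δ| + π), by positivity, fun x hx hδx => ?_⟩
  have hx0 : 0 < ‖x‖ := hδ.trans_le hδx
  have h1 : ‖exp (x * z)‖ ≤ Real.exp (‖z‖ * ‖x‖) := by
    rw [norm_exp]
    refine Real.exp_le_exp.mpr ((re_le_norm _).trans ?_)
    rw [norm_mul, mul_comm]
  have h2 : ‖log x‖ ≤ ‖x‖ + (|Real.log δ| + π) := by
    refine (norm_le_abs_re_add_abs_im _).trans ?_
    rw [log_re, log_im]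
    have h3 := abs_arg_le_pi x
    have h4 : |Real.log ‖x‖| ≤ ‖x‖ + |Real.log δ| := by
      rw [abs_le]
      constructor
      · have := Real.log_le_log hδ hδx
        have := neg_abs_le (Real.log δ)
        linarith
      · have := Real.log_le_sub_one_of_pos hx0
        have := abs_nonneg (Real.log δ)
        linarith
    linarith
  have h5 : ‖x‖ ≤ 1 / ε * Real.exp (ε * ‖x‖) := by
    have := Real.add_one_le_exp (ε * ‖x‖)
    rw [div_mul_eq_mul_div, one_mul, le_div_iff₀ hε0]
    linarith
  have h6 : (1 : ℝ) ≤ Real.exp (ε * ‖x‖) := Real.one_le_exp (by positivity)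
  have h7 : ‖log x‖ ≤ (1 / ε + (|Real.log δ| + π)) * Real.exp (ε * ‖x‖) := by
    refine h2.trans ?_
    rw [add_mul]
    have : 0 ≤ |Real.log δ| + π := by positivity
    nlinarith
  rw [norm_mul]
  refine (mul_le_mul h1 h7 (norm_nonneg _) (Real.exp_nonneg _)).trans (le_of_eq ?_)
  rw [mul_left_comm, ← Real.exp_add]
  congr 2; rw [hε]; ring

theorem differentiableOn_exp_mul_log (z : ℂ) :
    DifferentiableOn ℂ (fun x => exp (x * z) * log x) rightHalfPlane := by
  intro x hx
  have : DifferentiableAt ℂ log x := (hasDerivAt_log (Or.inl hx)).differentiableAt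
  exact DifferentiableAt.differentiableWithinAt (by fun_prop)

/-- The solution is in essence `rayRem z (x - 1)`. The difference equation rewrites it at argument
x, since the estimates hold only for Re y ≥ 0 and x - 1 may leave that region. -/
theorem isRamanujanRemainder_exp_mul_log (hz : ‖z‖ < π) :
    IsRamanujanRemainder (fun x => exp (x * z) * log x)
      (fun x => exp (x * z) * log x + rayRem z x) where
  analytic := (differentiableOn_exp_mul_log z).add (differentiableOn_rayRem hz.le)
  growth := by
    -- 7/4 = 3/2 + 1/4: the extra π/4 absorbs (1 + ‖x‖)², as 1 + ‖x‖ ≤ 4 e^{‖x‖/4} and π/4 > 1/2.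
    refine ⟨7 / 4 * π, by linarith [Real.pi_pos], fun δ hδ => ?_⟩
    obtain ⟨K, hK, hb⟩ := hasExpGrowth_exp_mul_log z
      (hz.trans (by linarith [Real.pi_pos] : π < 7 / 4 * π)) δ hδ
    obtain ⟨C, hC, hb'⟩ := exists_rayRem_bound hz.le
    refine ⟨K + C * 16, by positivity, fun x hx hδx => (norm_add_le _ _).trans ?_⟩
    rw [add_mul]
    refine add_le_add (hb x hx hδx) ((hb' x hx.le).trans ?_)
    have h1 : (1 + ‖x‖) ^ 2 ≤ 16 * Real.exp (1 / 4 * π * ‖x‖) := by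
      have h2 := Real.add_one_le_exp (‖x‖ / 4)
      have h3 : Real.exp (‖x‖ / 4) ^ 2 ≤ Real.exp (1 / 4 * π * ‖x‖) := by
        rw [← Real.exp_nat_mul]
        apply Real.exp_le_exp.mpr
        push_cast
        nlinarith [Real.pi_gt_three, norm_nonneg x]
      have h4 := norm_nonneg x
      nlinarith
    have h2 : Real.exp (7 / 4 * π * ‖x‖) =
        Real.exp (1 / 4 * π * ‖x‖) * Real.exp (3 / 2 * π * ‖x‖) := by
      rw [← Real.exp_add]; congr 1; ring
    rw [h2]
    calc C * ((1 + ‖x‖) ^ 2 * Real.exp (3 / 2 * π * ‖x‖))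
        ≤ C * (16 * Real.exp (1 / 4 * π * ‖x‖) * Real.exp (3 / 2 * π * ‖x‖)) := by gcongr
      _ = _ := by ring
  difference x hx := by
    linear_combination rayRem_sub hz.le (le_of_lt hx)
  normalised := by
    have h : ∀ t ∈ uIcc (1 : ℝ) 2, exp (t * z) * log t + rayRem z t = rayRem z ((t - 1 : ℝ) : ℂ) := by
      intro t ht
      rw [uIcc_of_le one_le_two] at ht
      have := rayRem_sub hz.le (y := ((t - 1 : ℝ) : ℂ)) (by simpa using ht.1)
      have e : ((t - 1 : ℝ) : ℂ) + 1 = t := by push_cast; ring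
      rw [e] at this
      rw [← this]; ring
    rw [intervalIntegral.integral_congr h,
      intervalIntegral.integral_comp_sub_right (fun y : ℝ => rayRem z y)]
    norm_num
    exact integral_rayRem hz.le

/-- The Ramanujan sum of `e^{nz} log n` as an integral along the path from `z` to `0` to `-∞`. -/
theorem hasRamanujanSum_exp_mul_log (hz : ‖z‖ < π) :
    HasRamanujanSum (fun x => exp (x * z) * log x) (rayRem z 0) := by
  obtain ⟨α, h1, h2⟩ := exists_between hz
  refine ⟨differentiableOn_exp_mul_log z, ⟨α, h2, hasExpGrowth_exp_mul_log z h1⟩, _,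
    isRamanujanRemainder_exp_mul_log hz,
    fun R' h' => (isRamanujanRemainder_exp_mul_log hz).eqOn h', ?_⟩
  have := rayRem_sub hz.le (y := 0) (by simp)
  simp only [zero_add, log_one, mul_zero] at this ⊢
  exact (sub_eq_zero.mp this).symm

/-- The part of `rayRem z 0` coming from the negative real axis. -/
noncomputable def axisInt (z : ℂ) : ℂ :=
  ∫ t in Ioi (0 : ℝ), exp (-t) * ((bernKer z - bernKer (-t)) / (z + t))

/-- The path is split at its corner t = 1, with u = 1 - t on the segment and t shifted by 1 on the
axis. -/
theorem rayRem_zero (hz : ‖z‖ ≤ π) : rayRem z 0 =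
    (∫ u in (0 : ℝ)..1, exp (u * z) * (bernKer z - bernKer (u * z)) / (1 - u)) + axisInt z := by
  have hint := integrableOn_rayKer hz (y := 0) le_rfl
  rw [rayRem, ← Ioc_union_Ioi_eq_Ioi (zero_le_one' ℝ), setIntegral_union (by
    rw [Set.disjoint_iff]; intro t ht; exact absurd ht.1.2 (not_le.mpr ht.2)) measurableSet_Ioi
    (hint.mono_set Ioc_subset_Ioi_self) (hint.mono_set (Ioi_subset_Ioi zero_le_one))]
  congr 1
  · have h := intervalIntegral.integral_comp_sub_left (a := 0) (b := 1)
      (fun u : ℝ => exp (u * z) * (bernKer z - bernKer (u * z)) / (1 - u)) 1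
    simp only [sub_self, sub_zero] at h
    rw [← h, intervalIntegral.integral_of_le zero_le_one]
    refine setIntegral_congr_fun measurableSet_Ioc fun t ht => ?_
    have ht0 : (t : ℂ) ≠ 0 := by exact_mod_cast ht.1.ne'
    have e : z - z * t = ((1 - t : ℝ) : ℂ) * z := by push_cast; ring
    have e2 : (1 : ℂ) - ((1 - t : ℝ) : ℂ) = t := by push_cast; ring
    simp only [rayKer, rayDisp_of_le ht.2, rayVel, if_pos ht.2, expRem_zero_left, e, e2]
    rcases eq_or_ne z 0 with rfl | hz0
    · simp
    · field_simp
  · have h : ∀ t ∈ Ioi (1 : ℝ), rayKer z 0 t =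
        exp (-((t - 1 : ℝ) : ℂ)) * ((bernKer z - bernKer (-((t - 1 : ℝ) : ℂ))) /
          (z + ((t - 1 : ℝ) : ℂ))) := by
      intro t ht
      have e : z - (z + (t - 1)) = -((t - 1 : ℝ) : ℂ) := by push_cast; ring
      have e2 : z + ((t : ℂ) - 1) = z + ((t - 1 : ℝ) : ℂ) := by push_cast; ring
      simp only [rayKer, rayDisp_of_ge (le_of_lt ht), rayVel, if_neg (not_le.mpr (mem_Ioi.mp ht)),
        expRem_zero_left, mul_one, e]
      rw [e2]
    rw [setIntegral_congr_fun measurableSet_Ioi h, axisInt]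
    have := (measurePreserving_add_right volume (1 : ℝ)).setIntegral_preimage_emb
      (measurableEmbedding_addRight 1) (fun t : ℝ => exp (-((t - 1 : ℝ) : ℂ)) *
      ((bernKer z - bernKer (-((t - 1 : ℝ) : ℂ))) / (z + ((t - 1 : ℝ) : ℂ)))) (Ioi 1)
    rw [← this]
    simp

/-- The Lipschitz bound on b gives the majorant C e^{-t}, uniform in z near 0. -/
theorem tendsto_axisInt : Tendsto axisInt (𝓝[≠] 0) (𝓝 (axisInt 0)) := by
  obtain ⟨C, hC, -, hl⟩ := exists_bernKer_bound
  have hball : ∀ᶠ z : ℂ in 𝓝[≠] 0, ‖z‖ ≤ π :=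
    eventually_nhdsWithin_of_eventually_nhds
      (Filter.mem_of_superset (Metric.closedBall_mem_nhds (0 : ℂ) Real.pi_pos)
        fun z hz => by simpa using hz)
  have hcont : ContinuousOn (fun t : ℝ => bernKer (-t)) (Ioi 0) :=
    continuousOn_bernKer.comp (by fun_prop : Continuous fun t : ℝ => -(t : ℂ)).continuousOn
      fun t ht => neg_ofReal_mem_halfStrip (le_of_lt ht)
  refine tendsto_integral_filter_of_dominated_convergence (fun t => C * Real.exp (-1 * t)) ?_ ?_
    (integrableOn_exp_neg_mul one_pos C) ?_
  · refine Eventually.of_forall fun z => ?_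
    have h1 : AEStronglyMeasurable (fun t : ℝ => bernKer z - bernKer (-t))
        (volume.restrict (Ioi (0 : ℝ))) :=
      (continuousOn_const.sub hcont).aestronglyMeasurable measurableSet_Ioi
    have h2 : Measurable fun t : ℝ => (z + t)⁻¹ :=
      (by fun_prop : Continuous fun t : ℝ => z + t).measurable.inv
    simp only [div_eq_mul_inv]
    exact (by fun_prop : Continuous fun t : ℝ => exp (-(t : ℂ))).aestronglyMeasurable.mul
      (h1.mul h2.aestronglyMeasurable)
  · filter_upwards [hball] with z hz
    filter_upwards [ae_restrict_mem measurableSet_Ioi] with t ht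
    rw [norm_mul, norm_exp, norm_div, mul_comm]
    have h1 := hl z (mem_halfStrip_of_norm_le hz) _ (neg_ofReal_mem_halfStrip (le_of_lt ht))
    rw [sub_neg_eq_add] at h1
    simp only [neg_re, ofReal_re, neg_one_mul]
    gcongr
    exact div_le_of_le_mul₀ (norm_nonneg _) hC h1
  · filter_upwards [ae_restrict_mem measurableSet_Ioi] with t ht
    have ht0 : (0 : ℂ) + t ≠ 0 := by rw [zero_add]; exact_mod_cast (ne_of_gt ht)
    have hc : ContinuousAt bernKer 0 :=
      (differentiableOn_bernKer.differentiableAt (isOpen_strip.mem_nhds (by simp [Real.pi_pos]))).continuousAt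
    have : ContinuousAt (fun z : ℂ => exp (-(t : ℂ)) * ((bernKer z - bernKer (-t)) / (z + t))) 0 :=
      continuousAt_const.mul ((hc.sub continuousAt_const).div
        (continuousAt_id.add continuousAt_const) ht0)
    exact this.tendsto.mono_left nhdsWithin_le_nhds

end Remainder

/-! ### Gauss' integral for ψ and the digamma term. -/

section Digamma

open Filter Complex MeasureTheory Set

/-- Two monotone functions with the same increments `1 / (x + 1)` differ by a constant. -/
theorem sub_eq_of_monotoneOn_of_add_one {f g : ℝ → ℝ} (hf : MonotoneOn f (Ici 0))
    (hg : MonotoneOn g (Ici 0)) (hf1 : ∀ x, 0 ≤ x → f (x + 1) - f x = 1 / (x + 1))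
    (hg1 : ∀ x, 0 ≤ x → g (x + 1) - g x = 1 / (x + 1)) {x : ℝ} (hx : x ∈ Icc (0 : ℝ) 1) :
    f x - g x = f 0 - g 0 := by
  have hper : ∀ (n : ℕ) (x : ℝ), 0 ≤ x → f (x + n) - g (x + n) = f x - g x := by
    intro n x hx
    induction n with
    | zero => simp
    | succ n ih =>
      have h0 : 0 ≤ x + n := by positivity
      have h1 := hf1 _ h0
      have h2 := hg1 _ h0
      push_cast
      rw [← add_assoc]
      linarith
  -- By periodicity of f - g the points x and 0 may be moved to n + x and n, where monotonicity
  -- traps each increment between 0 and 1/(n+1).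
  have hbd : ∀ n : ℕ, |(f x - g x) - (f 0 - g 0)| ≤ 1 / ((n : ℝ) + 1) := by
    intro n
    have hn : (0 : ℝ) ≤ n := n.cast_nonneg
    have key : ∀ h : ℝ → ℝ, MonotoneOn h (Ici 0) → (∀ x, 0 ≤ x → h (x + 1) - h x = 1 / (x + 1)) →
        0 ≤ h (x + n) - h n ∧ h (x + n) - h n ≤ 1 / ((n : ℝ) + 1) := by
      intro h hm h1
      have a1 := hm (mem_Ici.mpr hn) (mem_Ici.mpr (add_nonneg hx.1 hn)) (by linarith [hx.1])
      have a2 := hm (mem_Ici.mpr (add_nonneg hx.1 hn)) (mem_Ici.mpr (by linarith : 0 ≤ (n : ℝ) + 1))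
        (by linarith [hx.2])
      have a3 := h1 n hn
      exact ⟨by linarith, by linarith⟩
    have kf := key f hf hf1
    have kg := key g hg hg1
    have h1 := hper n x hx.1
    have h2 := hper n 0 le_rfl
    rw [zero_add] at h2
    rw [abs_le]
    constructor <;> linarith [kf.1, kf.2, kg.1, kg.2]
  have h0 : |(f x - g x) - (f 0 - g 0)| ≤ 0 :=
    ge_of_tendsto' tendsto_one_div_add_atTop_nhds_zero_nat hbd
  exact sub_eq_zero.mp (abs_nonpos_iff.mp h0)

/-- The derivative of the logarithm of the real Gamma function. -/
noncomputable def realDigamma : ℝ → ℝ := deriv (Real.log ∘ Real.Gamma)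

theorem hasDerivAt_log_Gamma {x : ℝ} (hx : 0 < x) :
    HasDerivAt (Real.log ∘ Real.Gamma) (deriv Real.Gamma x / Real.Gamma x) x :=
  (Real.differentiableAt_Gamma fun m => by
    have : (0 : ℝ) ≤ m := m.cast_nonneg
    linarith).hasDerivAt.log (Real.Gamma_pos_of_pos hx).ne'

theorem digamma_ofReal {x : ℝ} (hx : 0 < x) : digamma x = realDigamma x := by
  have hx' : ∀ m : ℕ, x ≠ -m := fun m => by
    have : (0 : ℝ) ≤ m := m.cast_nonneg
    linarith
  have h1 : HasDerivAt Gamma (deriv Gamma x) (x : ℂ) :=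
    (differentiableAt_Gamma _ fun m h => hx' m (by exact_mod_cast h)).hasDerivAt
  have h2 := h1.comp_ofReal
  have h3 := (Real.differentiableAt_Gamma hx').hasDerivAt.ofReal_comp
  simp only [Gamma_ofReal] at h2
  rw [digamma_def, logDeriv_apply, h2.unique h3, Gamma_ofReal, realDigamma,
    (hasDerivAt_log_Gamma hx).deriv]
  push_cast
  rfl

/-- This is the log-convexity of Γ. -/
theorem monotoneOn_realDigamma : MonotoneOn realDigamma (Ioi 0) :=
  Real.convexOn_log_Gamma.monotoneOn_deriv fun _ hx => (hasDerivAt_log_Gamma hx).differentiableAt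

theorem realDigamma_add_one {x : ℝ} (hx : 0 < x) : realDigamma (x + 1) = realDigamma x + 1 / x := by
  have h := digamma_apply_add_one (x : ℂ) fun m h => by
    have h1 : x = -(m : ℝ) := by exact_mod_cast h
    have : (0 : ℝ) ≤ m := m.cast_nonneg
    linarith
  have e : (x : ℂ) + 1 = ((x + 1 : ℝ) : ℂ) := by push_cast; rfl
  rw [e, digamma_ofReal (by linarith), digamma_ofReal hx] at h
  rw [one_div]
  exact_mod_cast h

theorem intervalIntegrable_realDigamma :
    IntervalIntegrable (fun x : ℝ => realDigamma (x + 1)) volume 0 1 := by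
  refine MonotoneOn.intervalIntegrable fun a ha b hb hab => ?_
  rw [uIcc_of_le zero_le_one] at ha hb
  exact monotoneOn_realDigamma (mem_Ioi.mpr (by linarith [ha.1])) (mem_Ioi.mpr (by linarith [hb.1]))
    (by linarith)

theorem integral_realDigamma : ∫ x in (0 : ℝ)..1, realDigamma (x + 1) = 0 := by
  have hd : ∀ x ∈ uIcc (0 : ℝ) 1, HasDerivAt (fun x => (Real.log ∘ Real.Gamma) (x + 1))
      (realDigamma (x + 1)) x := by
    intro x hx
    rw [uIcc_of_le zero_le_one] at hx
    exact HasDerivAt.comp_add_const x 1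
      (hasDerivAt_log_Gamma (by linarith [hx.1])).differentiableAt.hasDerivAt
  rw [intervalIntegral.integral_eq_sub_of_hasDerivAt hd intervalIntegrable_realDigamma]
  norm_num [Real.Gamma_two]

/-- The integrand of Gauss' integral for the digamma function. -/
noncomputable def gaussKer (x : ℂ) (t : ℝ) : ℂ := -(exp (-t) * expRem x (-t))

/-- Gauss' integral for `ψ (x + 1)`. -/
noncomputable def gaussInt (x : ℂ) : ℂ := ∫ t in Ioi (0 : ℝ), gaussKer x t

theorem exists_gaussKer_bound : ∃ C : ℝ, 0 ≤ C ∧ ∀ y : ℂ, 0 ≤ y.re → ∀ t ∈ Ioi (0 : ℝ),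
    ‖gaussKer y t‖ ≤ (C * ((1 + ‖y‖) ^ 2 * Real.exp (3 / 2 * π * ‖y‖)) + (1 / 2 + ‖y‖)) * 2 *
      Real.exp (-(1 / 2) * t) := by
  obtain ⟨C, hC, hl⟩ := exists_expRem_lipschitz
  refine ⟨C, hC, fun y hy t ht => ?_⟩
  have ht0 : 0 ≤ t := le_of_lt ht
  set L := C * ((1 + ‖y‖) ^ 2 * Real.exp (3 / 2 * π * ‖y‖))
  have hL : 0 ≤ L := by positivity
  have h1 := hl y hy _ (neg_ofReal_mem_halfStrip ht0) 0 (mem_halfStrip_of_norm_le (by simp [Real.pi_pos.le]))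
  have h2 : expRem y 0 = 1 / 2 - y := by simp [expRem, expQuot_zero, bernKer_zero]
  rw [sub_zero, norm_neg, norm_real, Real.norm_of_nonneg ht0] at h1
  have h3 : ‖expRem y 0‖ ≤ 1 / 2 + ‖y‖ := by
    rw [h2]; refine (norm_sub_le _ _).trans ?_; simp
  have h4 : ‖expRem y (-t)‖ ≤ (L + (1 / 2 + ‖y‖)) * (1 + t) := by
    have := norm_le_norm_add_norm_sub (expRem y 0) (expRem y (-t))
    have h5 := norm_nonneg y
    rw [norm_sub_rev] at this
    nlinarith
  -- Half of the decay e^{-t} pays for the linear growth of E_y(-t).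
  have h5 : 1 + t ≤ 2 * Real.exp (1 / 2 * t) := by
    linarith [Real.add_one_le_exp (1 / 2 * t)]
  rw [gaussKer, norm_neg, norm_mul, norm_exp]
  simp only [neg_re, ofReal_re]
  calc Real.exp (-t) * ‖expRem y (-t)‖
      ≤ Real.exp (-t) * ((L + (1 / 2 + ‖y‖)) * (2 * Real.exp (1 / 2 * t))) := by
        refine mul_le_mul_of_nonneg_left (h4.trans ?_) (Real.exp_nonneg _)
        gcongr
    _ = (L + (1 / 2 + ‖y‖)) * 2 * (Real.exp (-t) * Real.exp (1 / 2 * t)) := by ring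
    _ = _ := by rw [← Real.exp_add]; congr 2; ring

theorem aestronglyMeasurable_gaussKer (y : ℂ) :
    AEStronglyMeasurable (gaussKer y) (volume.restrict (Ioi (0 : ℝ))) := by
  have h1 : ContinuousOn (fun t : ℝ => expRem y (-t)) (Ioi (0 : ℝ)) :=
    ContinuousOn.expRem continuousOn_const (by fun_prop)
      fun t ht => neg_ofReal_mem_halfStrip (le_of_lt ht)
  have h2 : Continuous fun t : ℝ => exp (-(t : ℂ)) := by fun_prop
  exact (h2.continuousOn.mul h1).neg.aestronglyMeasurable measurableSet_Ioi

theorem integrableOn_gaussKer {y : ℂ} (hy : 0 ≤ y.re) : IntegrableOn (gaussKer y) (Ioi 0) := by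
  obtain ⟨C, hC, hb⟩ := exists_gaussKer_bound
  refine Integrable.mono' (integrableOn_exp_neg_mul (by norm_num : (0 : ℝ) < 1 / 2) _)
    (aestronglyMeasurable_gaussKer y)
    ((ae_restrict_mem measurableSet_Ioi).mono fun t ht => hb y hy t ht)

theorem gaussInt_add_one {y : ℂ} (hy : 0 ≤ y.re) : gaussInt (y + 1) - gaussInt y = 1 / (y + 1) := by
  have hy1 : 0 < (y + 1).re := by simp; linarith
  rw [gaussInt, gaussInt, ← integral_sub (integrableOn_gaussKer hy1.le) (integrableOn_gaussKer hy)]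
  have h : ∀ t ∈ Ioi (0 : ℝ), gaussKer (y + 1) t - gaussKer y t = exp (-(y + 1) * t) := by
    intro t ht
    have h1 := expRem_sub y (im_lt_of_mem_halfStrip (neg_ofReal_mem_halfStrip (le_of_lt ht)))
    have h2 : exp (-(y + 1) * t) = exp (-t) * exp (y * -t) := by
      rw [← exp_add]; congr 1; ring
    rw [h2, ← h1, gaussKer, gaussKer]; ring
  rw [setIntegral_congr_fun measurableSet_Ioi h,
    integral_exp_mul_complex_Ioi (by rw [neg_re]; linarith)]
  simp only [ofReal_zero, mul_zero, exp_zero]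
  rw [div_neg, neg_div, neg_neg]

/-- The real form of `gaussKer`. -/
theorem gaussKer_ofReal (x : ℝ) {t : ℝ} (ht : t ∈ Ioi (0 : ℝ)) : gaussKer x t =
    ((-(Real.exp (-t) * (Real.exp (x * -t) / (1 - Real.exp (-t)) + 1 / -t)) : ℝ) : ℂ) := by
  have ht0 : (-(t : ℂ)) ≠ 0 := neg_ne_zero.mpr (by exact_mod_cast (ne_of_gt ht))
  rw [gaussKer, expRem_of_ne _ (im_lt_of_mem_halfStrip (neg_ofReal_mem_halfStrip (le_of_lt ht))) ht0]
  push_cast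
  rfl

theorem gaussInt_ofReal (x : ℝ) : gaussInt x = ((gaussInt x).re : ℂ) := by
  rw [gaussInt, setIntegral_congr_fun measurableSet_Ioi fun t ht => gaussKer_ofReal x ht,
    integral_complex_ofReal, ofReal_re]

/-- For each t only e^{-xt} depends on x, and it enters with a negative coefficient. -/
theorem monotoneOn_gaussInt : MonotoneOn (fun x : ℝ => (gaussInt x).re) (Ici 0) := by
  intro a ha b hb hab
  have hre : ∀ x : ℝ, 0 ≤ x → (gaussInt x).re = ∫ t in Ioi (0 : ℝ), (gaussKer x t).re :=
    fun x hx => (integral_re (integrableOn_gaussKer (by simpa using hx))).symm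
  simp only [hre a ha, hre b hb]
  refine setIntegral_mono_on (integrableOn_gaussKer (by simpa using ha)).re
    (integrableOn_gaussKer (by simpa using hb)).re measurableSet_Ioi fun t ht => ?_
  rw [gaussKer_ofReal a ht, gaussKer_ofReal b ht, ofReal_re, ofReal_re]
  have ht0 : 0 < t := ht
  have h1 : 0 < 1 - Real.exp (-t) := by
    rw [sub_pos, Real.exp_lt_one_iff]; linarith
  have h2 : Real.exp (b * -t) ≤ Real.exp (a * -t) := Real.exp_le_exp.mpr (by nlinarith)
  gcongr

theorem intervalIntegral_gaussInt_mul {φ : ℝ → ℂ} (hφ : Continuous φ) :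
    ∫ x in (0 : ℝ)..1, gaussInt x * φ x =
      ∫ t in Ioi (0 : ℝ), -exp (-t) * ∫ x in (0 : ℝ)..1, expRem x (-t) * φ x := by
  obtain ⟨C, hC, hb⟩ := exists_gaussKer_bound
  obtain ⟨M, hM⟩ := isCompact_Icc.exists_bound_of_continuousOn (s := Icc (0 : ℝ) 1) hφ.continuousOn
  have hswap : Integrable (Function.uncurry fun (x : ℝ) t => gaussKer x t * φ x)
      ((volume.restrict (uIoc 0 1)).prod (volume.restrict (Ioi (0 : ℝ)))) := by
    have hg : Integrable (fun p : ℝ × ℝ => M *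
        ((C * ((1 + 1) ^ 2 * Real.exp (3 / 2 * π * 1)) + (1 / 2 + 1)) * 2 *
          Real.exp (-(1 / 2) * p.2)))
        ((volume.restrict (uIoc 0 1)).prod (volume.restrict (Ioi (0 : ℝ)))) := by
      refine Integrable.mul_prod (f := fun _ : ℝ => M) ?_
        (integrableOn_exp_neg_mul (by norm_num : (0 : ℝ) < 1 / 2) _)
      rw [uIoc_of_le zero_le_one]
      exact integrable_const _
    refine hg.mono' ?_ ?_
    · rw [Measure.prod_restrict]
      refine ContinuousOn.aestronglyMeasurable ?_ (measurableSet_uIoc.prod measurableSet_Ioi)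
      have h1 : ContinuousOn (fun p : ℝ × ℝ => expRem p.1 (-p.2)) (uIoc 0 1 ×ˢ Ioi (0 : ℝ)) :=
        ContinuousOn.expRem (by fun_prop) (by fun_prop)
          fun p hp => neg_ofReal_mem_halfStrip (le_of_lt hp.2)
      have h2 : Continuous fun p : ℝ × ℝ => exp (-(p.2 : ℂ)) := by fun_prop
      exact (h2.continuousOn.mul h1).neg.mul (hφ.comp continuous_fst).continuousOn
    rw [Measure.prod_restrict]
    filter_upwards [ae_restrict_mem (measurableSet_uIoc.prod measurableSet_Ioi)] with p hp
    obtain ⟨h1, h2⟩ := hp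
    rw [uIoc_of_le zero_le_one] at h1
    have hn : ‖(p.1 : ℂ)‖ ≤ 1 := by rw [norm_real, Real.norm_of_nonneg h1.1.le]; exact h1.2
    have h3 := hM p.1 ⟨h1.1.le, h1.2⟩
    rw [Function.uncurry, norm_mul, mul_comm]
    refine mul_le_mul h3 ((hb p.1 (by simpa using h1.1.le) p.2 h2).trans ?_) (norm_nonneg _)
      ((norm_nonneg _).trans h3)
    gcongr
  simp only [gaussInt, ← integral_mul_const]
  rw [intervalIntegral_integral_swap hswap]
  refine setIntegral_congr_fun measurableSet_Ioi fun t _ => ?_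
  simp only [gaussKer]
  rw [← intervalIntegral.integral_const_mul]
  exact intervalIntegral.integral_congr fun x _ => by ring

theorem integral_gaussInt : ∫ x in (0 : ℝ)..1, gaussInt x = 0 := by
  have h := intervalIntegral_gaussInt_mul (φ := fun _ => 1) continuous_const
  simp only [mul_one] at h
  rw [h]
  refine setIntegral_eq_zero_of_forall_eq_zero fun t ht => ?_
  rw [integral_expRem (im_lt_of_mem_halfStrip (neg_ofReal_mem_halfStrip (le_of_lt ht))), mul_zero]

/-- Gauss' integral representation of the digamma function on `[1, 2]`. -/
theorem digamma_add_one_eq_gaussInt {x : ℝ} (hx : x ∈ Icc (0 : ℝ) 1) :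
    digamma (x + 1) = gaussInt x := by
  set Q : ℝ → ℝ := fun x => (gaussInt x).re with hQ
  have hmono : MonotoneOn (fun x : ℝ => realDigamma (x + 1)) (Ici 0) := fun a ha b hb hab =>
    monotoneOn_realDigamma (mem_Ioi.mpr (by linarith [mem_Ici.mp ha]))
      (mem_Ioi.mpr (by linarith [mem_Ici.mp hb])) (by linarith)
  have hconst : ∀ x ∈ Icc (0 : ℝ) 1, realDigamma (x + 1) - Q x = realDigamma (0 + 1) - Q 0 := by
    intro x hx
    refine sub_eq_of_monotoneOn_of_add_one (f := fun x => realDigamma (x + 1)) hmono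
      monotoneOn_gaussInt (fun x hx => ?_) (fun x hx => ?_) hx
    · rw [realDigamma_add_one (by linarith : 0 < x + 1)]; ring
    · have h := congrArg re (gaussInt_add_one (y := x) (by simpa using hx))
      have e : (1 : ℂ) / ((x : ℂ) + 1) = ((1 / (x + 1) : ℝ) : ℂ) := by push_cast; rfl
      rw [e, ofReal_re, sub_re] at h
      rw [← h]
      simp
  have hQi : IntervalIntegrable Q volume 0 1 := MonotoneOn.intervalIntegrable
    (monotoneOn_gaussInt.mono (by rw [uIcc_of_le zero_le_one]; exact Icc_subset_Ici_self))
  have hQ0 : ∫ x in (0 : ℝ)..1, Q x = 0 := by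
    have h := integral_gaussInt
    rw [intervalIntegral.integral_congr (g := fun x : ℝ => ((Q x : ℝ) : ℂ))
      fun x _ => gaussInt_ofReal x, intervalIntegral.integral_ofReal] at h
    exact_mod_cast h
  -- Both functions have mean zero on [0, 1], which forces their constant difference to be 0.
  have h1 : ∫ x in (0 : ℝ)..1, (realDigamma (x + 1) - Q x) = realDigamma (0 + 1) - Q 0 := by
    rw [intervalIntegral.integral_congr (g := fun _ => realDigamma (0 + 1) - Q 0) fun x hx =>
      hconst x (by rwa [uIcc_of_le zero_le_one] at hx)]
    simp
  rw [intervalIntegral.integral_sub intervalIntegrable_realDigamma hQi, integral_realDigamma, hQ0,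
    sub_zero] at h1
  have h2 := hconst x hx
  rw [← h1, sub_eq_zero] at h2
  have e : (x : ℂ) + 1 = ((x + 1 : ℝ) : ℂ) := by push_cast; rfl
  rw [e, digamma_ofReal (by linarith [hx.1]), h2, gaussInt_ofReal]

theorem intervalIntegrable_digamma_mul_exp (z : ℂ) : IntervalIntegrable
    (fun x : ℝ => digamma ((x : ℂ) + 1) * exp (-z * (x : ℂ))) volume 0 1 := by
  have h1 : IntervalIntegrable (fun x : ℝ => digamma ((x : ℂ) + 1)) volume 0 1 := by
    have h : IntervalIntegrable (fun x : ℝ => ((realDigamma (x + 1) : ℝ) : ℂ)) volume 0 1 :=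
      ⟨intervalIntegrable_realDigamma.1.ofReal, intervalIntegrable_realDigamma.2.ofReal⟩
    refine h.congr fun x hx => ?_
    rw [uIoc_of_le zero_le_one] at hx
    rw [← digamma_ofReal (by linarith [hx.1])]
    push_cast
    rfl
  exact h1.mul_continuousOn
    (by fun_prop : Continuous fun x : ℝ => exp (-z * (x : ℂ))).continuousOn

theorem integral_expRem_mul_exp {z w : ℂ} (hz : |z.im| < 2 * π) (hw : |w.im| < 2 * π) (hz0 : z ≠ 0)
    (hw0 : w ≠ 0) (hzw : z ≠ w) : ∫ x in (0 : ℝ)..1, expRem x w * exp (-z * x) =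
      -((exp z - 1) / exp z * ((bernKer z - bernKer w) / (z - w))) := by
  have h1 := sub_ne_zero.mpr (exp_ne_one_of_im_lt hw hw0).symm
  have h2 := sub_ne_zero.mpr (exp_ne_one_of_im_lt hz hz0).symm
  have h3 := sub_ne_zero.mpr hzw
  have h3' := sub_ne_zero.mpr hzw.symm
  have e : ∀ x : ℝ, expRem x w * exp (-z * x) =
      (1 - exp w)⁻¹ * exp ((w - z) * x) + w⁻¹ * exp (-z * x) := by
    intro x
    have : exp ((w - z) * x) = exp (x * w) * exp (-z * x) := by rw [← exp_add]; congr 1; ring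
    rw [expRem_of_ne _ hw hw0, this]; ring
  simp only [e]
  have hi : ∀ c d : ℂ, IntervalIntegrable (fun x : ℝ => d * exp (c * x)) volume 0 1 := fun c d =>
    (by fun_prop : Continuous fun x : ℝ => d * exp (c * x)).intervalIntegrable _ _
  rw [intervalIntegral.integral_add (hi _ _) (hi _ _), intervalIntegral.integral_const_mul,
    intervalIntegral.integral_const_mul, integral_exp_mul_complex h3',
    integral_exp_mul_complex (neg_ne_zero.mpr hz0), bernKer_of_ne hw hw0, bernKer_of_ne hz hz0]
  have h4 := exp_ne_zero z
  have e3 : exp z - 1 ≠ 0 := by rw [← neg_sub]; exact neg_ne_zero.mpr h2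
  simp only [ofReal_one, ofReal_zero, mul_one, mul_zero, exp_zero, exp_sub, exp_neg]
  have h5 : w - z = -(z - w) := by ring
  rw [h5]
  generalize hA : exp z = A at *
  generalize hB : exp w = B at *
  field_simp
  ring

/-- After Gauss' integral is inserted and the order exchanged, the x-integral is elementary, and its
factor (e^z - 1)/e^z cancels the prefactor. -/
theorem digammaTerm_eq_axisInt {z : ℂ} (hz : ‖z‖ ≤ π) (hz0 : z ≠ 0) :
    digammaTerm z = axisInt z := by
  have him := im_lt_of_mem_halfStrip (mem_halfStrip_of_norm_le hz)
  have h1 : ∫ x in (0 : ℝ)..1, digamma ((x : ℂ) + 1) * exp (-z * (x : ℂ)) =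
      ∫ x in (0 : ℝ)..1, gaussInt x * exp (-z * x) := by
    refine intervalIntegral.integral_congr fun x hx => ?_
    rw [uIcc_of_le zero_le_one] at hx
    simp only [digamma_add_one_eq_gaussInt hx]
  rw [digammaTerm, h1, intervalIntegral_gaussInt_mul (by fun_prop), axisInt, ← integral_const_mul]
  refine integral_congr_ae ?_
  have hae : ∀ᵐ t : ℝ, t ≠ -z.re := by simp [ae_iff]
  filter_upwards [ae_restrict_mem measurableSet_Ioi, ae_restrict_of_ae hae] with t ht ht'
  have ht0 : (-(t : ℂ)) ≠ 0 := neg_ne_zero.mpr (by exact_mod_cast (ne_of_gt ht))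
  have hzt : z ≠ -(t : ℂ) := by
    intro h
    have := congrArg re h
    simp at this
    exact ht' (by linarith)
  have h2 : exp z - 1 ≠ 0 := sub_ne_zero.mpr (exp_ne_one_of_im_lt him hz0)
  rw [integral_expRem_mul_exp him
    (im_lt_of_mem_halfStrip (neg_ofReal_mem_halfStrip (le_of_lt ht))) hz0 ht0 hzt, sub_neg_eq_add]
  have h3 := exp_ne_zero z
  field_simp

end Digamma

/-! ### Bernoulli expansions, harmonic numbers and the two series. -/

section Series

open Filter Complex MeasureTheory

/-- Taylor coefficients of `z / (e^z - 1)`. -/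
noncomputable def bernCoeff (n : ℕ) : ℂ := (bernoulli n : ℂ) / (n.factorial : ℂ)

/-- Euler's formula for ζ(2k), with ζ(2k) ≤ ζ(2) = π²/6 ≤ 2. -/
theorem norm_bernCoeff_two_mul_le {k : ℕ} (hk : k ≠ 0) :
    ‖bernCoeff (2 * k)‖ ≤ 4 / (2 * π) ^ (2 * k) := by
  have h1 := hasSum_zeta_nat hk
  have h2 : (∑' n : ℕ, 1 / (n : ℝ) ^ (2 * k)) ≤ 2 := by
    refine (Summable.tsum_le_tsum (fun n => ?_) h1.summable hasSum_zeta_two.summable).trans ?_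
    · rcases n.eq_zero_or_pos with rfl | hn
      · simp [hk]
      · have : (1 : ℝ) ≤ n := by exact_mod_cast hn
        gcongr
        omega
    · rw [hasSum_zeta_two.tsum_eq]
      have := Real.pi_lt_d2
      nlinarith [Real.pi_pos]
  have h0 : 0 ≤ ∑' n : ℕ, 1 / (n : ℝ) ^ (2 * k) := tsum_nonneg fun n => by positivity
  rw [h1.tsum_eq] at h0 h2
  rw [← abs_of_nonneg h0, abs_div, abs_mul, abs_mul, abs_mul, abs_pow, abs_neg, abs_one, one_pow,
    one_mul, abs_of_pos (by positivity : (0 : ℝ) < 2 ^ (2 * k - 1)),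
    abs_of_pos (by positivity : (0 : ℝ) < π ^ (2 * k)), Nat.abs_cast] at h2
  have h3 : ‖bernCoeff (2 * k)‖ = |(bernoulli (2 * k) : ℝ)| / ((2 * k).factorial : ℝ) := by
    rw [bernCoeff, norm_div, Complex.norm_natCast, ← ofReal_ratCast, norm_real, Real.norm_eq_abs]
  have h4 : (2 * π) ^ (2 * k) = 2 * (2 ^ (2 * k - 1) * π ^ (2 * k)) := by
    rw [mul_pow, ← mul_assoc, ← pow_succ']
    congr 2
    omega
  rw [h3, le_div_iff₀ (by positivity), h4]
  calc _ = 2 * (2 ^ (2 * k - 1) * π ^ (2 * k) * |(bernoulli (2 * k) : ℝ)| /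
      ((2 * k).factorial : ℝ)) := by ring
    _ ≤ 2 * 2 := by gcongr
    _ = 4 := by norm_num

theorem norm_bernCoeff_le (n : ℕ) : ‖bernCoeff n‖ ≤ 4 / (2 * π) ^ n := by
  rcases Nat.even_or_odd' n with ⟨k, rfl | rfl⟩
  · rcases eq_or_ne k 0 with rfl | hk
    · norm_num [bernCoeff]
    · exact norm_bernCoeff_two_mul_le hk
  · rcases eq_or_ne k 0 with rfl | hk
    · norm_num [bernCoeff, bernoulli_one]
      rw [le_div_iff₀ (by positivity)]
      linarith [Real.pi_lt_d2]
    · rw [bernCoeff, bernoulli_eq_zero_of_odd ⟨k, rfl⟩ (by omega)]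
      simp
      positivity

theorem norm_bernCoeff_mul_pow_le (n : ℕ) (w : ℂ) :
    ‖bernCoeff n * w ^ n‖ ≤ 4 * (‖w‖ / (2 * π)) ^ n := by
  rw [norm_mul, norm_pow, div_pow, mul_div_assoc', ← div_mul_eq_mul_div]
  gcongr
  exact norm_bernCoeff_le n

theorem summable_norm_bernCoeff {w : ℂ} (hw : ‖w‖ < 2 * π) :
    Summable fun n => ‖bernCoeff n * w ^ n‖ := by
  refine Summable.of_nonneg_of_le (fun n => norm_nonneg _)
    (fun n => norm_bernCoeff_mul_pow_le n w) ?_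
  exact (summable_geometric_of_lt_one (by positivity)
    ((div_lt_one Real.two_pi_pos).mpr hw)).mul_left 4

theorem hasSum_exp (w : ℂ) : HasSum (fun n : ℕ => w ^ n / (n.factorial : ℂ)) (exp w) := by
  rw [exp_eq_exp_ℂ]
  exact NormedSpace.expSeries_div_hasSum_exp w

/-- Absolute convergence for ‖w‖ < 2π lets the formal generating function identity be evaluated by a
Cauchy product. -/
theorem tsum_bernCoeff_mul {w : ℂ} (hw : ‖w‖ < 2 * π) :
    (∑' n, bernCoeff n * w ^ n) * (exp w - 1) = w := by
  set e : ℕ → ℂ := fun n => PowerSeries.coeff n (PowerSeries.exp ℂ - 1) with he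
  have hee : ∀ n, e n * w ^ n = w ^ n / (n.factorial : ℂ) - if n = 0 then 1 else 0 := by
    intro n
    simp only [he, map_sub, PowerSeries.coeff_exp, PowerSeries.coeff_one]
    rcases eq_or_ne n 0 with rfl | hn
    · simp
    · simp [hn]; ring
  have h1 : HasSum (fun n => e n * w ^ n) (exp w - 1) := by
    simp only [hee]
    exact (hasSum_exp w).sub (hasSum_ite_eq 0 1)
  have h2 := tsum_mul_tsum_eq_tsum_sum_antidiagonal_of_summable_norm (summable_norm_bernCoeff hw)
    h1.summable.norm
  rw [h1.tsum_eq] at h2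
  rw [h2]
  have h3 : ∀ n, ∑ p ∈ Finset.HasAntidiagonal.antidiagonal n, bernCoeff p.1 * w ^ p.1 * (e p.2 * w ^ p.2) =
      if n = 1 then w else 0 := by
    intro n
    have h4 := congrArg (PowerSeries.coeff n) (bernoulliPowerSeries_mul_exp_sub_one ℂ)
    rw [PowerSeries.coeff_mul, PowerSeries.coeff_X] at h4
    have h5 : ∀ p ∈ Finset.HasAntidiagonal.antidiagonal n, bernCoeff p.1 * w ^ p.1 * (e p.2 * w ^ p.2) =
        w ^ n * (PowerSeries.coeff p.1 (bernoulliPowerSeries ℂ) *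
          PowerSeries.coeff p.2 (PowerSeries.exp ℂ - 1)) := by
      intro p hp
      rw [← Finset.HasAntidiagonal.mem_antidiagonal.mp hp, pow_add]
      simp only [bernCoeff, he, bernoulliPowerSeries, PowerSeries.coeff_mk]
      simp
      ring
    rw [Finset.sum_congr rfl h5, ← Finset.mul_sum, h4]
    split_ifs with h
    · simp [h]
    · simp
  simp only [h3, tsum_ite_eq]

theorem hasSum_bernKer {w : ℂ} (hw : ‖w‖ < 2 * π) :
    HasSum (fun n => -(bernCoeff (n + 1) * w ^ n)) (bernKer w) := by
  rcases eq_or_ne w 0 with rfl | h0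
  · have := hasSum_single (f := fun n => -(bernCoeff (n + 1) * (0 : ℂ) ^ n)) 0
      fun n hn => by simp [hn]
    convert this using 1
    norm_num [bernKer_zero, bernCoeff, bernoulli_one]
  have him : |w.im| < 2 * π := (abs_im_le_norm w).trans_lt hw
  have h1 := sub_ne_zero.mpr (exp_ne_one_of_im_lt him h0)
  have h2 := sub_ne_zero.mpr (exp_ne_one_of_im_lt him h0).symm
  have h3 := (summable_norm_bernCoeff hw).of_norm.hasSum
  rw [← hasSum_nat_add_iff' 1] at h3
  have h4 := h3.mul_left (-w⁻¹)
  have h5 := tsum_bernCoeff_mul hw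
  rw [← eq_div_iff h1] at h5
  have e1 : ∀ n, -w⁻¹ * (bernCoeff (n + 1) * w ^ (n + 1)) = -(bernCoeff (n + 1) * w ^ n) := by
    intro n
    rw [pow_succ]; field_simp
  have e2 : -w⁻¹ * (w / (exp w - 1) - ∑ i ∈ Finset.range 1, bernCoeff i * w ^ i) = bernKer w := by
    rw [bernKer_of_ne him h0]
    simp [bernCoeff]
    field_simp
    ring
  simp only [h5, e1] at h4
  rwa [e2] at h4

theorem hasSum_expQuot (w : ℂ) :
    HasSum (fun n : ℕ => w ^ n / ((n + 1).factorial : ℂ)) (expQuot w) := by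
  rcases eq_or_ne w 0 with rfl | h0
  · have := hasSum_single (f := fun n : ℕ => (0 : ℂ) ^ n / ((n + 1).factorial : ℂ)) 0
      fun n hn => by simp [hn]
    convert this using 1
    simp [expQuot_zero]
  have h3 := hasSum_exp w
  rw [← hasSum_nat_add_iff' 1] at h3
  have h4 := h3.mul_left w⁻¹
  have e1 : ∀ n : ℕ, w⁻¹ * (w ^ (n + 1) / ((n + 1).factorial : ℂ)) =
      w ^ n / ((n + 1).factorial : ℂ) := by
    intro n
    rw [pow_succ]; field_simp
  have e2 : w⁻¹ * (exp w - ∑ i ∈ Finset.range 1, w ^ i / (i.factorial : ℂ)) = expQuot w := by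
    rw [expQuot_of_ne h0]; simp; field_simp
  simp only [e1] at h4
  rwa [e2] at h4

theorem norm_harmonic_le (k : ℕ) : ‖(harmonic k : ℂ)‖ ≤ k := by
  induction k with
  | zero => simp
  | succ k ih =>
    rw [harmonic_succ]
    push_cast
    refine (norm_add_le _ _).trans (add_le_add ih ?_)
    rw [norm_inv]
    refine inv_le_one_of_one_le₀ ?_
    have : ((k : ℂ) + 1) = ((k + 1 : ℕ) : ℂ) := by push_cast; rfl
    rw [this, Complex.norm_natCast]
    exact_mod_cast Nat.succ_pos k

/-- Termwise integration against `1 / (1 - u)` produces harmonic numbers. -/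
theorem hasSum_mul_harmonic {c : ℕ → ℂ} (hc : Summable fun k : ℕ => (k : ℝ) * ‖c k‖) {φ : ℝ → ℂ} {A : ℂ}
    (hA : HasSum c A) (hφ : ∀ u ∈ Set.Ioo (0 : ℝ) 1, HasSum (fun k => c k * (u : ℂ) ^ k) (φ u)) :
    HasSum (fun k => c k * (harmonic k : ℂ)) (∫ u in (0 : ℝ)..1, (A - φ u) / (1 - u)) := by
  -- The geometric sum is (1 - u^k)/(1 - u) away from u = 1; it integrates to H_k and is at most k,
  -- whence the majorant k‖c k‖.
  set F : ℕ → ℝ → ℂ := fun k u => c k * ∑ j ∈ Finset.range k, (u : ℂ) ^ j with hF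
  have hcont : ∀ k, Continuous (F k) := fun k => by fun_prop
  have hFint : ∀ k, ∫ u in (0 : ℝ)..1, F k u = c k * (harmonic k : ℂ) := by
    intro k
    simp only [hF]
    rw [intervalIntegral.integral_const_mul, intervalIntegral.integral_finsetSum fun j _ =>
      (by fun_prop : Continuous fun u : ℝ => (u : ℂ) ^ j).intervalIntegrable _ _]
    congr 1
    simp only [harmonic, Rat.cast_sum]
    refine Finset.sum_congr rfl fun j _ => ?_
    have : ∀ u : ℝ, (u : ℂ) ^ j = ((u ^ j : ℝ) : ℂ) := fun u => by push_cast; rfl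
    simp only [this]
    rw [intervalIntegral.integral_ofReal, integral_pow]
    simp
  simp only [← hFint]
  refine intervalIntegral.hasSum_integral_of_dominated_convergence (fun k _ => (k : ℝ) * ‖c k‖)
    (fun k => (hcont k).aestronglyMeasurable) (fun k => ?_) (Eventually.of_forall fun _ _ => hc)
    intervalIntegrable_const ?_
  · refine Eventually.of_forall fun u hu => ?_
    rw [Set.uIoc_of_le zero_le_one] at hu
    simp only [hF]
    rw [norm_mul, mul_comm]
    gcongr
    refine (norm_sum_le _ _).trans ?_
    have : ∀ j ∈ Finset.range k, ‖(u : ℂ) ^ j‖ ≤ 1 := fun j _ => by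
      rw [norm_pow, norm_real, Real.norm_of_nonneg hu.1.le]
      exact pow_le_one₀ hu.1.le hu.2
    refine (Finset.sum_le_sum this).trans ?_
    simp
  · have hne : ∀ᵐ u : ℝ, u ≠ 1 := by simp [ae_iff]
    filter_upwards [hne] with u hu1 hu
    rw [Set.uIoc_of_le zero_le_one] at hu
    have h1 : (1 : ℂ) - u ≠ 0 := sub_ne_zero.mpr (by exact_mod_cast hu1.symm)
    have h2 := (hA.sub (hφ u ⟨hu.1, lt_of_le_of_ne hu.2 hu1⟩)).div_const (1 - (u : ℂ))
    refine h2.congr_fun fun k => ?_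
    simp only [hF]
    rw [geom_sum_eq (by exact_mod_cast hu1)]
    have h3 : (u : ℂ) - 1 ≠ 0 := sub_ne_zero.mpr (by exact_mod_cast hu1)
    field_simp
    ring

/-- Taylor terms of `(e^z - 1) / z + bernKer z`. -/
noncomputable def remTerm (z : ℂ) (k : ℕ) : ℂ :=
  z ^ k / ((k + 1).factorial : ℂ) - bernCoeff (k + 1) * z ^ k

variable {z : ℂ}

theorem firstTerm_eq (z : ℂ) (k : ℕ) : firstTerm z k = remTerm z k * (harmonic k : ℂ) := by
  rw [firstTerm, remTerm, bernCoeff, Nat.factorial_succ]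
  have h1 : (k.factorial : ℂ) ≠ 0 := by exact_mod_cast k.factorial_ne_zero
  have h2 : (k : ℂ) + 1 ≠ 0 := by exact_mod_cast k.succ_ne_zero
  push_cast
  field_simp

theorem summable_nat_mul_exp (z : ℂ) :
    Summable fun k : ℕ => (k : ℝ) * ‖z ^ k / (k.factorial : ℂ)‖ := by
  refine Summable.of_nonneg_of_le (fun k => by positivity) (fun k => ?_)
    (Real.summable_pow_div_factorial (2 * ‖z‖))
  rw [norm_div, norm_pow, Complex.norm_natCast, mul_pow, mul_div_assoc]
  gcongr
  exact_mod_cast k.lt_two_pow_self.le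

theorem summable_nat_mul_remTerm (hz : ‖z‖ < 2 * π) :
    Summable fun k : ℕ => (k : ℝ) * ‖remTerm z k‖ := by
  set r := ‖z‖ / (2 * π)
  have hr : ‖r‖ < 1 := by
    rw [Real.norm_of_nonneg (by positivity)]
    exact (div_lt_one Real.two_pi_pos).mpr hz
  refine Summable.of_nonneg_of_le (fun k => by positivity) (fun k => ?_)
    ((summable_nat_mul_exp z).add
      ((summable_pow_mul_geometric_of_norm_lt_one 1 hr).mul_left (4 / (2 * π))))
  rw [remTerm]
  refine (mul_le_mul_of_nonneg_left (norm_sub_le _ _) k.cast_nonneg).trans ?_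
  rw [mul_add]
  refine add_le_add ?_ ?_
  · rw [norm_div, norm_div, Complex.norm_natCast, Complex.norm_natCast]
    gcongr
    exact k.le_succ
  · rw [norm_mul, norm_pow, pow_one]
    have h1 : ‖bernCoeff (k + 1)‖ * ‖z‖ ^ k ≤ 4 / (2 * π) * r ^ k := by
      calc ‖bernCoeff (k + 1)‖ * ‖z‖ ^ k ≤ 4 / (2 * π) ^ (k + 1) * ‖z‖ ^ k := by
            gcongr; exact norm_bernCoeff_le _
        _ = _ := by simp only [r]; rw [pow_succ, div_pow]; field_simp
    calc (k : ℝ) * (‖bernCoeff (k + 1)‖ * ‖z‖ ^ k) ≤ k * (4 / (2 * π) * r ^ k) := by gcongr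
      _ = _ := by ring

theorem summable_mul_harmonic {c : ℕ → ℂ} (hc : Summable fun k : ℕ => (k : ℝ) * ‖c k‖) :
    Summable fun k => ‖c k * (harmonic k : ℂ)‖ := by
  refine Summable.of_nonneg_of_le (fun k => norm_nonneg _) (fun k => ?_) hc
  rw [norm_mul, mul_comm]
  gcongr
  exact norm_harmonic_le k

theorem summable_firstTerm (hz : ‖z‖ < 2 * π) : Summable (firstTerm z) := by
  rw [funext (firstTerm_eq z)]
  exact (summable_mul_harmonic (summable_nat_mul_remTerm hz)).of_norm

theorem secondTerm_eq (z : ℂ) (k : ℕ) : secondTerm z k =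
    ∑ p ∈ Finset.HasAntidiagonal.antidiagonal k, bernCoeff (p.1 + 1) * z ^ p.1 *
      (z ^ p.2 / (p.2.factorial : ℂ) * (harmonic p.2 : ℂ)) := by
  rw [secondTerm, Finset.Nat.sum_antidiagonal_eq_sum_range_succ
    (fun i j => bernCoeff (i + 1) * z ^ i * (z ^ j / (j.factorial : ℂ) * (harmonic j : ℂ))),
    ← Finset.Ico_succ_right_eq_Icc, Finset.sum_Ico_eq_sum_range, Finset.mul_sum]
  refine Finset.sum_congr (by simp) fun i hi => ?_
  have hi' : i ≤ k := by simp at hi; omega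
  have h1 : k + 1 - (1 + i) = k - i := by omega
  have h2 : z ^ k = z ^ i * z ^ (k - i) := by rw [← pow_add]; congr 1; omega
  rw [h1, h2, bernCoeff, add_comm 1 i]
  ring

/-- With m = i + 1 the inner sum is a Cauchy product, whose first factor Σ B_{i+1} z^i/(i+1)! equals
-b(z). -/
theorem hasSum_secondTerm (hz : ‖z‖ < 2 * π) : HasSum (secondTerm z)
    (-bernKer z * ∑' k : ℕ, z ^ k / (k.factorial : ℂ) * (harmonic k : ℂ)) := by
  have h1 := (hasSum_bernKer hz).neg
  simp only [neg_neg] at h1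
  have h2 := summable_mul_harmonic (summable_nat_mul_exp z)
  rw [← h1.tsum_eq, tsum_mul_tsum_eq_tsum_sum_antidiagonal_of_summable_norm h1.summable.norm h2]
  simp only [← secondTerm_eq]
  refine Summable.hasSum ?_
  rw [funext (secondTerm_eq z)]
  exact (summable_norm_sum_mul_antidiagonal_of_summable_norm h1.summable.norm h2).of_norm

theorem tsum_firstTerm_add_tsum_secondTerm (hz : ‖z‖ < 2 * π) :
    ∑' k, firstTerm z k + ∑' k, secondTerm z k =
      ∫ u in (0 : ℝ)..1, exp (u * z) * (bernKer z - bernKer (u * z)) / (1 - u) := by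
  -- These are the coefficients in u of 1 + e^{uz} b(uz) - b(z) e^{uz}, which equals 1 at u = 1;
  -- subtracting it from 1 leaves e^{uz} (b(z) - b(uz)).
  set c : ℕ → ℂ := fun k => remTerm z k - bernKer z * (z ^ k / (k.factorial : ℂ)) with hcdef
  have hgen : ∀ w : ℂ, ‖w‖ < 2 * π → HasSum (remTerm w) (expQuot w + bernKer w) := by
    intro w hw
    refine ((hasSum_expQuot w).add (hasSum_bernKer hw)).congr_fun fun k => ?_
    rw [remTerm, sub_eq_add_neg]
  have hc : Summable fun k : ℕ => (k : ℝ) * ‖c k‖ := by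
    refine Summable.of_nonneg_of_le (fun k => by positivity) (fun k => ?_)
      ((summable_nat_mul_remTerm hz).add ((summable_nat_mul_exp z).mul_left ‖bernKer z‖))
    refine (mul_le_mul_of_nonneg_left (norm_sub_le _ _) k.cast_nonneg).trans (le_of_eq ?_)
    rw [norm_mul]; ring
  have hid : ∀ w : ℂ, ‖w‖ < 2 * π → expQuot w + bernKer w = 1 + exp w * bernKer w := by
    intro w hw
    linear_combination bernKer_mul w ((abs_im_le_norm w).trans_lt hw)
  have hA : HasSum c 1 := by
    have := (hgen z hz).sub ((hasSum_exp z).mul_left (bernKer z))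
    rwa [hid z hz, mul_comm (exp z), add_sub_cancel_right] at this
  have hφ : ∀ u ∈ Set.Ioo (0 : ℝ) 1, HasSum (fun k => c k * (u : ℂ) ^ k)
      (1 + exp (u * z) * bernKer (u * z) - bernKer z * exp (u * z)) := by
    intro u hu
    have huz : ‖(u : ℂ) * z‖ < 2 * π := by
      rw [norm_mul, norm_real, Real.norm_of_nonneg hu.1.le]
      exact (mul_le_of_le_one_left (norm_nonneg z) hu.2.le).trans_lt hz
    have := (hgen _ huz).sub ((hasSum_exp (u * z)).mul_left (bernKer z))
    rw [hid _ huz] at this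
    refine this.congr_fun fun k => ?_
    simp only [hcdef, remTerm, mul_pow]
    ring
  have h1 := hasSum_mul_harmonic hc hA hφ
  have h2 := (hasSum_secondTerm hz).tsum_eq
  have h3 := ((summable_mul_harmonic (summable_nat_mul_exp z)).of_norm.hasSum).mul_left (-bernKer z)
  have h4 := (summable_firstTerm hz).hasSum.add h3
  have h5 : ∀ k, firstTerm z k + -bernKer z * (z ^ k / (k.factorial : ℂ) * (harmonic k : ℂ)) =
      c k * (harmonic k : ℂ) := by
    intro k
    rw [firstTerm_eq]; simp only [hcdef]; ring
  simp only [h5] at h4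
  rw [h2, h4.unique h1]
  refine intervalIntegral.integral_congr fun u _ => ?_
  ring

theorem firstTerm_zero_right (z : ℂ) : firstTerm z 0 = 0 := by simp [firstTerm]

theorem secondTerm_zero_right (z : ℂ) : secondTerm z 0 = 0 := by simp [secondTerm]

end Series

/-! ### Assembly of the formula. -/

/-- Both series run over `k ≥ 1`, written as `k + 1` with `k : ℕ`. At `z = 0` the digamma term has a
removable singularity and stands for its limit there. -/
theorem lemma1 (z : ℂ) (hz : ‖z‖ < π) :
    IntervalIntegrable
      (fun x : ℝ => Complex.digamma ((x : ℂ) + 1) * Complex.exp (-z * (x : ℂ)))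
      MeasureTheory.volume 0 1 ∧
    Summable (fun k : ℕ => firstTerm z (k + 1)) ∧
    Summable (fun k : ℕ => secondTerm z (k + 1)) ∧
    (z ≠ 0 →
      HasRamanujanSum (fun x : ℂ => Complex.exp (x * z) * Complex.log x)
        (digammaTerm z + ∑' k : ℕ, firstTerm z (k + 1) + ∑' k : ℕ, secondTerm z (k + 1))) ∧
    (z = 0 →
      ∃ L : ℂ, Filter.Tendsto digammaTerm (𝓝[≠] 0) (𝓝 L) ∧
        HasRamanujanSum (fun x : ℂ => Complex.exp (x * z) * Complex.log x)
          (L + ∑' k : ℕ, firstTerm z (k + 1) + ∑' k : ℕ, secondTerm z (k + 1))) := by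
  have hz2 : ‖z‖ < 2 * π := hz.trans (by linarith [Real.pi_pos])
  have h1 := summable_firstTerm hz2
  have h2 := (hasSum_secondTerm hz2).summable
  have hsum : rayRem z 0 =
      axisInt z + ∑' k : ℕ, firstTerm z (k + 1) + ∑' k : ℕ, secondTerm z (k + 1) := by
    have h := tsum_firstTerm_add_tsum_secondTerm hz2
    -- The terms at k = 0 vanish because H_0 = 0, so the sums over k ≥ 0 and k ≥ 1 agree.
    rw [h1.tsum_eq_zero_add, h2.tsum_eq_zero_add, firstTerm_zero_right, secondTerm_zero_right,
      zero_add, zero_add] at h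
    rw [rayRem_zero hz.le, ← h]
    ring
  have hR := hasRamanujanSum_exp_mul_log hz
  rw [hsum] at hR
  refine ⟨intervalIntegrable_digamma_mul_exp z, (summable_nat_add_iff 1).mpr h1,
    (summable_nat_add_iff 1).mpr h2, fun hz0 => ?_, fun hz0 => ?_⟩
  · rwa [digammaTerm_eq_axisInt hz.le hz0]
  · subst hz0
    refine ⟨axisInt 0, tendsto_axisInt.congr' ?_, hR⟩
    have hball : ∀ᶠ w : ℂ in 𝓝[≠] 0, ‖w‖ ≤ π :=
      eventually_nhdsWithin_of_eventually_nhds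
        (Filter.mem_of_superset (Metric.closedBall_mem_nhds (0 : ℂ) Real.pi_pos)
          fun w hw => by simpa using hw)
    filter_upwards [hball, self_mem_nhdsWithin] with w hw hw0
    exact (digammaTerm_eq_axisInt hw hw0).symm
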